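/- Let $0<q<1$, let $r\ge 1$, $0\le a<r$, $N\ge 0$ be integers and let $u,v\in\mathbb{C}$ satisfy $r\,\mathrm{Re}\,u>-1$ and $q^{r(v+n)}\ne 1$ for all integers $n\ge 1$ (for real $v$: $v\notin\{-1,-2,\dots\}$). **Notation.** $(x;q)_\infty=\prod_{i\ge0}(1-q^ix)$, $(x;q)_v=(x;q)_\infty/(xq^v;q)_\infty$, $\Gamma_q(x)=(1-q)^{1-x}(q;q)_{x-1}$ (with $1/\Gamma_q=0$ at the poles of $\Gamma_q$), $[z]_q=(1-q^z)/(1-q)$, $\omega_r=e^{2\pi i/r}$. The $N$-fold Jackson integral is $$\int_0^{b_1}\!\!\cdots\int_0^{b_N}F(x)\,d_qx_1\cdots d_qx_N=\sum_{k\in\mathbb{Z}_{\ge0}^N}\Big(\prod_i(1-q)b_iq^{k_i}\Big)F(q^{k_1}b_1,\dots,q^{k_N}b_N),$$ and $\int_{C_{r,a}^N}$ is defined multilinearly from $C_{r,a}=\sum_{j=0}^{r-1}\omega_r^{-ja}[0,\omega_r^j]$. For a symmetric function $\mathcal O$ put $$Z_N^{(r,a)}[\mathcal O]=\frac1{N!}\int_{C_{r,a}^N}\prod_{i=1}^N\frac{d_qx_i}{2\pi}(x_i^r)^u(q^rx_i^r;q^r)_v\prod_{i<j}(x_i-x_j)^2\;\mathcal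 O(x),\qquad Z_N^{(r,a)}=Z_N^{(r,a)}[1],\qquad \langle\mathcal O\rangle^{(r,a)}=\frac{Z_N^{(r,a)}[\mathcal O]}{Z_N^{(r,a)}} .$$ For a partition $\lambda$ with at most $N$ rows, $s_\lambda(x)=\det(x_i^{N+\lambda_j-j})/\det(x_i^{N-j})$. With $\tilde a=r-a$, $$\delta_{r,a}(N)=(-1)^{\lceil N/r\rceil\frac{a(a-1)}2+\lfloor N/r\rfloor\frac{\tilde a(\tilde a-1)}2}\ \text{ if } N\equiv 0\text{ or }a\pmod r,\qquad \delta_{r,a}(N)=0\ \text{ otherwise.}$$ For $0\le\mu<r$ let $n_\mu=\lfloor\frac{N-\mu-1}r\rfloor+1$, $u_\mu=u+\frac ar+\lfloor\frac{N-\mu-a-1}r\rfloor-\lfloor\frac{N-\mu-1}r\rfloor$, and $n_r(N,u)=\sum_{\mu=0}^{r-1}\big[(u_\mu+1)\binom{n_\mu}2+2\binom{n_\mu}3\big]$. For a partition $\lambda$ and $0\le\mu<r$ let $I_{\mu,i}$ ($i\ge1$) be the $i$-th index $I\ge1$ with $I-\lambda_I-1\equiv\mu\pmod r$. The $r$-signature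 $\delta_r(\lambda)$ is the sign of the permutation $\widehat\sigma(I_{\mu,i})=1+r(i-1)+\mu$ of $\{1,2,\dots\}$ if it moves only finitely many elements, and $0$ otherwise. There is an integer $i_\mu$ with $I_{\mu,i}=1+r(i-i_\mu-1)+\mu$ for all large $i$, and the $r$-quotient of $\lambda$ consists of the partitions $\lambda/r^{(\mu)}$ with parts $(\lambda/r^{(\mu)})_i=i-i_\mu-1+\frac{\lambda_{I_{\mu,i}}-I_{\mu,i}+\mu+1}r$. Put $n(\kappa)=\sum_i(i-1)\kappa_i$ and $n_r(\lambda)=\sum_{\mu=0}^{r-1}n(\lambda/r^{(\mu)})$. For a box $x=(i,j)\in\lambda$ let $c_\lambda(x)=j-i$ and $h_\lambda(x)=\lambda_i+\lambda_j^\top-i-j+1$. Finally let $\llbracket n;x\rrbracket^{(q)}_{r,b}=[n+x]_q$ if $n\equiv b\pmod r$ and $=1$ otherwise, and $\llbracket n\rrbracket^{(q)}_{r,b}=\llbracket n;0\rrbracket^{(q)}_{r,b}$. **Claim.** The Jackson sums defining $Z_N^{(r,a)}$ and $Z_N^{(r,a)}[s_\lambda]$ converge absolutely on each product of rays; $$Z_N^{(r,a)}=\frac{\delta_{r,a}(N)}{(2\pi)^N}(q^r)^{n_r(N,u)}\Big(\frac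 r{[r]_q}\Big)^N\prod_{I=0}^{N-1}\frac{\Gamma_{q^r}\big(\lfloor\frac{I-a}r\rfloor+\frac ar+u+1\big)\,\Gamma_{q^r}\big(\lfloor\frac Ir\rfloor+v+1\big)\,\Gamma_{q^r}\big(\lfloor\frac Ir\rfloor+1\big)}{\Gamma_{q^r}\big(\lfloor\frac{N+I-a}r\rfloor+\frac ar+u+v+1\big)};$$ and, whenever $Z_N^{(r,a)}\ne0$, for every partition $\lambda$ with at most $N$ rows $$\langle s_\lambda\rangle^{(r,a)}=\delta_r(\lambda)\,(q^r)^{n_r(\lambda)}\prod_{x\in\lambda}\frac{\llbracket N+c_\lambda(x)\rrbracket^{(q)}_{r,0}\,\llbracket N+c_\lambda(x);ru\rrbracket^{(q)}_{r,a}}{\llbracket h_\lambda(x)\rrbracket^{(q)}_{r,0}\,\llbracket 2N+c_\lambda(x);ru+rv\rrbracket^{(q)}_{r,a}} .$$ -/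

import Mathlib

open scoped BigOperators

namespace RFoldQSelberg

noncomputable section

/-! ### q-calculus (`0 < q < 1` real, all powers have a positive real base) -/

/-- The infinite `q`-Pochhammer symbol `(x;q)_∞ = ∏_{i ≥ 0} (1 - q^i x)`. -/
def qPochInf (q : ℝ) (x : ℂ) : ℂ := ∏' i : ℕ, (1 - (q : ℂ) ^ i * x)

/-- `(x;q)_v = (x;q)_∞ / (x q^v;q)_∞` for a complex index `v`. -/
def qPoch (q : ℝ) (x v : ℂ) : ℂ := qPochInf q x / qPochInf q (x * (q : ℂ) ^ v)

/-- `Γ_q(x) = (1-q)^{1-x} (q;q)_{x-1}`. -/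
def qGamma (q : ℝ) (x : ℂ) : ℂ := (1 - (q : ℂ)) ^ (1 - x) * qPoch q (q : ℂ) (x - 1)

/-- The `q`-number `[z]_q = (1-q^z)/(1-q)`. -/
def qNumber (q : ℝ) (z : ℂ) : ℂ := (1 - (q : ℂ) ^ z) / (1 - (q : ℂ))

/-- The term of index `k` in the `N`-fold Jackson integral of `F` over `∏ᵢ [0, bᵢ]`. -/
def jacksonTerm (q : ℝ) {N : ℕ} (b : Fin N → ℂ) (F : (Fin N → ℂ) → ℂ) (k : Fin N → ℕ) : ℂ :=
  (∏ i, (1 - (q : ℂ)) * b i * (q : ℂ) ^ k i) * F (fun i => (q : ℂ) ^ k i * b i)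

/-- The `N`-fold Jackson integral `∫_0^{b_1} ⋯ ∫_0^{b_N} F(x) d_q x_1 ⋯ d_q x_N`. -/
def jacksonIntegral (q : ℝ) {N : ℕ} (b : Fin N → ℂ) (F : (Fin N → ℂ) → ℂ) : ℂ :=
  ∑' k : Fin N → ℕ, jacksonTerm q b F k

/-! ### The contour and the model -/

/-- `ω_r = e^{2π i / r}`. -/
def omega (r : ℕ) : ℂ := Complex.exp (2 * Real.pi * Complex.I / r)

/-- The end points `(ω_r^{j_1}, …, ω_r^{j_N})` of a product of rays. -/
def rayEnd (r : ℕ) {N : ℕ} (j : Fin N → Fin r) : Fin N → ℂ := fun i => omega r ^ (j i : ℕ)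

/-- The Jackson integral over `C_{r,a}^N`, where `C_{r,a} = ∑_{j<r} ω_r^{-ja} [0, ω_r^j]`. -/
def contourIntegral (q : ℝ) (r a : ℕ) {N : ℕ} (F : (Fin N → ℂ) → ℂ) : ℂ :=
  ∑ j : Fin N → Fin r,
    (∏ i, (omega r ^ ((j i : ℕ) * a))⁻¹) * jacksonIntegral q (rayEnd r j) F

/-- The integrand with an insertion `O`. -/
def integrand (q : ℝ) (r : ℕ) (u v : ℂ) {N : ℕ} (O : (Fin N → ℂ) → ℂ) (x : Fin N → ℂ) : ℂ :=
  O x *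
    (∏ i, (1 / (2 * (Real.pi : ℂ))) * (x i ^ r) ^ u *
      qPoch (q ^ r) ((q : ℂ) ^ r * x i ^ r) v) *
    ∏ i, ∏ j ∈ Finset.Ioi i, (x i - x j) ^ 2

/-- The unnormalized average `Z_N^{(r,a)}[O]` of an insertion `O`. -/
def ZIns (q : ℝ) (r a : ℕ) (u v : ℂ) (N : ℕ) (O : (Fin N → ℂ) → ℂ) : ℂ :=
  (1 / (N.factorial : ℂ)) * contourIntegral q r a (integrand q r u v O)

/-- The partition function `Z_N^{(r,a)}`. -/
def Z (q : ℝ) (r a : ℕ) (u v : ℂ) (N : ℕ) : ℂ := ZIns q r a u v N (fun _ => 1)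

/-- The normalized average `⟨O⟩^{(r,a)} = Z_N^{(r,a)}[O] / Z_N^{(r,a)}`. -/
def average (q : ℝ) (r a : ℕ) (u v : ℂ) (N : ℕ) (O : (Fin N → ℂ) → ℂ) : ℂ :=
  ZIns q r a u v N O / Z q r a u v N

/-- The Schur polynomial `s_l(x) = det x_i^{N + l_j - j} / det x_i^{N - j}`
(the column index `j` is zero-based below).
Points with coinciding coordinates, where the quotient is not defined, do not contribute to any
average, since the integrand carries the squared Vandermonde determinant. -/
def schur {N : ℕ} (l : YoungDiagram) (x : Fin N → ℂ) : ℂ :=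
  (Matrix.of fun i j : Fin N => x i ^ (N - (j + 1) + l.rowLen j)).det /
    (Matrix.of fun i j : Fin N => x i ^ (N - ((j : ℕ) + 1))).det

/-! ### Data entering the partition function (integer division `/` by `r > 0` is the floor) -/

/-- The sign `δ_{r,a}(N)`; here `(N + r - 1) / r = ⌈N / r⌉`. -/
def deltaN (r a N : ℕ) : ℤ :=
  if N % r = 0 ∨ N % r = a then
    (-1) ^ (((N + r - 1) / r) * (a * (a - 1) / 2) + (N / r) * ((r - a) * (r - a - 1) / 2))
  else 0

/-- `n_μ = ⌊(N - μ - 1)/r⌋ + 1`, a nonnegative integer for `μ < r`. -/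
def nMu (r N μ : ℕ) : ℕ := (((N : ℤ) - μ - 1) / (r : ℤ) + 1).toNat

/-- `u_μ = u + a/r + ⌊(N - μ - a - 1)/r⌋ - ⌊(N - μ - 1)/r⌋`. -/
def uMu (r a : ℕ) (u : ℂ) (N μ : ℕ) : ℂ :=
  u + (a : ℂ) / r + ((((N : ℤ) - μ - a - 1) / (r : ℤ) - ((N : ℤ) - μ - 1) / (r : ℤ) : ℤ) : ℂ)

/-- `n_r(N,u) = ∑_μ [(u_μ + 1) C(n_μ, 2) + 2 C(n_μ, 3)]`. -/
def nrN (r a : ℕ) (u : ℂ) (N : ℕ) : ℂ :=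
  ∑ μ ∈ Finset.range r,
    ((uMu r a u N μ + 1) * ((nMu r N μ).choose 2 : ℂ) + 2 * ((nMu r N μ).choose 3 : ℂ))

/-- `⌊(m - b)/r⌋`, as a complex number. -/
def fl (r m b : ℕ) : ℂ := ((((m : ℤ) - b) / (r : ℤ) : ℤ) : ℂ)

/-! ### Partitions: `r`-signature and `r`-quotient

Rows, columns and the indices `I`, `i` below are numbered from `0`, so `l.rowLen I` is the part
with (one-based) number `I + 1`. -/

/-- The residue of `I - l_I` modulo `r`, in `{0, …, r-1}`. -/
def residue (r : ℕ) (l : YoungDiagram) (I : ℕ) : ℕ := (((I : ℤ) - l.rowLen I) % (r : ℤ)).toNat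

/-- `I_{μ,i}`: the `i`th index `I` with `I - l_I ≡ μ (mod r)`. -/
def idx (r : ℕ) (l : YoungDiagram) (μ i : ℕ) : ℕ := Nat.nth (fun I => residue r l I = μ) i

/-- The map `σ̂ : I_{μ,i} ↦ r i + μ` on indices. -/
def sigmaHat (r : ℕ) (l : YoungDiagram) (I : ℕ) : ℕ :=
  r * Nat.count (fun J => residue r l J = residue r l I) I + residue r l I

open Classical in
/-- The `r`-signature `δ_r(l)`: the signature of the permutation `σ̂` of the indices, computed as
`(-1)` to the number of inversions, when `σ̂` moves finitely many indices, and `0` otherwise. -/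
def rSignature (r : ℕ) (l : YoungDiagram) : ℤ :=
  if {I : ℕ | sigmaHat r l I ≠ I}.Finite then
    (-1) ^ {p : ℕ × ℕ | p.1 < p.2 ∧ sigmaHat r l p.2 < sigmaHat r l p.1}.ncard
  else 0

/-- The remainder `(l mod r)_μ`, i.e. the integer `i_μ` with `I_{μ,i} = r (i - i_μ) + μ` whenever
`I_{μ,i}` is at least the number of rows; `i = l.colLen 0` is such a value. -/
def remainder (r : ℕ) (l : YoungDiagram) (μ : ℕ) : ℤ :=
  (l.colLen 0 : ℤ) - ((idx r l μ (l.colLen 0) : ℤ) - μ) / (r : ℤ)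

/-- The parts of the `μ`th component `l / r^{(μ)}` of the `r`-quotient (the division is exact). -/
def quotientRow (r : ℕ) (l : YoungDiagram) (μ i : ℕ) : ℤ :=
  (i : ℤ) - remainder r l μ +
    ((l.rowLen (idx r l μ i) : ℤ) - idx r l μ i + μ) / (r : ℤ)

/-- `n_r(l) = ∑_μ n(l / r^{(μ)})`, where `n(κ) = ∑_i i κ_i` with `i` zero-based; the components
of the quotient have at most as many rows as `l`. -/
def nrPart (r : ℕ) (l : YoungDiagram) : ℤ :=
  ∑ μ ∈ Finset.range r, ∑ i ∈ Finset.range (l.colLen 0), (i : ℤ) * quotientRow r l μ i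

/-- The content `c(x)` of a box `x = (row, column)`. -/
def content (x : ℕ × ℕ) : ℤ := (x.2 : ℤ) - x.1

/-- The hook length `h_l(x)` of a box `x = (row, column)` of `l`. -/
def hook (l : YoungDiagram) (x : ℕ × ℕ) : ℤ :=
  (l.rowLen x.1 : ℤ) + l.colLen x.2 - x.1 - x.2 - 1

/-- The bracket `⟦n; x⟧_{r,a}^{(q)}`: `[n + x]_q` if `n ≡ a (mod r)`, and `1` otherwise. -/
def bracket (q : ℝ) (r a : ℕ) (n : ℤ) (x : ℂ) : ℂ :=
  if n ≡ (a : ℤ) [ZMOD (r : ℤ)] then qNumber q (n + x) else 1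

end

end RFoldQSelberg

open RFoldQSelberg

namespace RFoldQSelberg

open Filter Topology

section QSeries

variable {q : ℝ}

lemma norm_ofReal_lt_one (hq0 : 0 < q) (hq1 : q < 1) : ‖(q : ℂ)‖ < 1 := by
  rw [Complex.norm_real, Real.norm_eq_abs, abs_of_pos hq0]; exact hq1

lemma summable_pow_mul (hq0 : 0 < q) (hq1 : q < 1) (x : ℂ) :
    Summable fun i : ℕ => -((q : ℂ) ^ i * x) :=
  ((summable_geometric_of_norm_lt_one (norm_ofReal_lt_one hq0 hq1)).mul_right x).neg

lemma multipliable_qPochInf (hq0 : 0 < q) (hq1 : q < 1) (x : ℂ) :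
    Multipliable fun i : ℕ => 1 - (q : ℂ) ^ i * x := by
  simpa [sub_eq_add_neg] using
    Complex.multipliable_one_add_of_summable (summable_pow_mul hq0 hq1 x)

lemma qPochInf_ne_zero (hq0 : 0 < q) (hq1 : q < 1) {x : ℂ}
    (hx : ∀ i : ℕ, (q : ℂ) ^ i * x ≠ 1) : qPochInf q x ≠ 0 := by
  have := tprod_one_add_ne_zero_of_summable (f := fun i : ℕ => -((q : ℂ) ^ i * x))
    (fun i => by
      rw [← sub_eq_add_neg, sub_ne_zero]; exact (hx i).symm) (summable_pow_mul hq0 hq1 x).norm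
  simpa [qPochInf, sub_eq_add_neg] using this

lemma tendsto_qPochInf (hq0 : 0 < q) (hq1 : q < 1) (x : ℂ) :
    Tendsto (fun n => ∏ i ∈ Finset.range n, (1 - (q : ℂ) ^ i * x)) atTop (𝓝 (qPochInf q x)) :=
  (multipliable_qPochInf hq0 hq1 x).tendsto_prod_tprod_nat

lemma qPochInf_eq_prod_mul (hq0 : 0 < q) (hq1 : q < 1) (x : ℂ) (n : ℕ) :
    qPochInf q x = (∏ i ∈ Finset.range n, (1 - (q : ℂ) ^ i * x)) * qPochInf q ((q : ℂ) ^ n * x) := by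
  have h1 := (tendsto_add_atTop_iff_nat n).2 (tendsto_qPochInf hq0 hq1 x)
  have h2 := (tendsto_qPochInf hq0 hq1 ((q : ℂ) ^ n * x)).const_mul
    (∏ i ∈ Finset.range n, (1 - (q : ℂ) ^ i * x))
  refine tendsto_nhds_unique h1 (h2.congr fun m => ?_)
  rw [add_comm, Finset.prod_range_add]
  congr 1
  refine Finset.prod_congr rfl fun i _ => ?_
  ring

lemma pow_mul_ne_one (hq0 : 0 < q) (hq1 : q < 1) {z : ℂ} (hz : ‖z‖ < 1) (i : ℕ) :
    (q : ℂ) ^ i * z ≠ 1 := by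
  intro h
  have h1 : ‖(q : ℂ) ^ i * z‖ = 1 := by rw [h, norm_one]
  rw [norm_mul, norm_pow] at h1
  have h2 : ‖(q : ℂ)‖ ^ i ≤ 1 := pow_le_one₀ (norm_nonneg _) (norm_ofReal_lt_one hq0 hq1).le
  nlinarith [norm_nonneg z]

/-- The coefficients `(a;q)_k / (q;q)_k` of the `q`-binomial series. -/
noncomputable def qBinomCoeff (q : ℝ) (a : ℂ) (k : ℕ) : ℂ :=
  (∏ i ∈ Finset.range k, (1 - (q : ℂ) ^ i * a)) / ∏ i ∈ Finset.range k, (1 - (q : ℂ) ^ i * q)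

lemma qBinomCoeff_succ (hq0 : 0 < q) (hq1 : q < 1) (a : ℂ) (k : ℕ) :
    qBinomCoeff q a (k + 1) * (1 - (q : ℂ) ^ (k + 1)) = qBinomCoeff q a k * (1 - (q : ℂ) ^ k * a) := by
  have h : ∀ i : ℕ, (1 : ℂ) - (q : ℂ) ^ i * q ≠ 0 := fun i =>
    sub_ne_zero.2 (pow_mul_ne_one hq0 hq1 (norm_ofReal_lt_one hq0 hq1) i).symm
  have hp := Finset.prod_ne_zero_iff.2 fun i (_ : i ∈ Finset.range k) => h i
  have hk := h k
  rw [qBinomCoeff, qBinomCoeff, Finset.prod_range_succ, Finset.prod_range_succ, pow_succ]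
  generalize ∏ i ∈ Finset.range k, (1 - (q : ℂ) ^ i * q) = A at *
  generalize ∏ i ∈ Finset.range k, (1 - (q : ℂ) ^ i * a) = B at *
  rw [div_mul_eq_mul_div, div_mul_eq_mul_div, div_eq_div_iff (mul_ne_zero hp hk) hp]
  ring

lemma exists_norm_qBinomCoeff_le (hq0 : 0 < q) (hq1 : q < 1) (a : ℂ) :
    ∃ M, ∀ k, ‖qBinomCoeff q a k‖ ≤ M := by
  have h := (tendsto_qPochInf hq0 hq1 a).div (tendsto_qPochInf hq0 hq1 (q : ℂ))
    (qPochInf_ne_zero hq0 hq1 (pow_mul_ne_one hq0 hq1 (norm_ofReal_lt_one hq0 hq1)))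
  obtain ⟨M, hM⟩ := h.norm.bddAbove_range
  exact ⟨M, fun k => hM ⟨k, rfl⟩⟩

lemma summable_qBinom (hq0 : 0 < q) (hq1 : q < 1) (a : ℂ) {z : ℂ} (hz : ‖z‖ < 1) :
    Summable fun k => qBinomCoeff q a k * z ^ k := by
  obtain ⟨M, hM⟩ := exists_norm_qBinomCoeff_le hq0 hq1 a
  refine Summable.of_norm_bounded
    ((summable_geometric_of_lt_one (norm_nonneg z) hz).mul_left M) fun k => ?_
  rw [norm_mul, norm_pow]
  exact mul_le_mul_of_nonneg_right (hM k) (by positivity)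

lemma tsum_qBinom_functional (hq0 : 0 < q) (hq1 : q < 1) (a : ℂ) {z : ℂ} (hz : ‖z‖ < 1) :
    (1 - z) * ∑' k, qBinomCoeff q a k * z ^ k =
      (1 - a * z) * ∑' k, qBinomCoeff q a k * ((q : ℂ) * z) ^ k := by
  have hqz : ‖(q : ℂ) * z‖ < 1 := by
    rw [norm_mul]
    nlinarith [norm_nonneg z, norm_ofReal_lt_one hq0 hq1, norm_nonneg (q : ℂ)]
  have s1 := summable_qBinom hq0 hq1 a hz
  have s2 := summable_qBinom hq0 hq1 a hqz
  have e : ∑' k, (qBinomCoeff q a k * z ^ k - qBinomCoeff q a k * ((q : ℂ) * z) ^ k) =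
      ∑' k, (z * (qBinomCoeff q a k * z ^ k) - a * z * (qBinomCoeff q a k * ((q : ℂ) * z) ^ k)) := by
    rw [(s1.sub s2).tsum_eq_zero_add]
    simp only [pow_zero, sub_self, zero_add]
    refine tsum_congr fun k => ?_
    have := qBinomCoeff_succ hq0 hq1 a k
    rw [mul_pow, mul_pow]
    linear_combination z ^ (k + 1) * this
  rw [s1.tsum_sub s2, (s1.mul_left z).tsum_sub (s2.mul_left (a * z)), tsum_mul_left,
    tsum_mul_left] at e
  linear_combination e

/-- The `q`-binomial theorem. -/
lemma tsum_qBinom (hq0 : 0 < q) (hq1 : q < 1) (a : ℂ) {z : ℂ} (hz : ‖z‖ < 1) :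
    ∑' k, qBinomCoeff q a k * z ^ k = qPochInf q (a * z) / qPochInf q z := by
  have hn := norm_ofReal_lt_one hq0 hq1
  set F : ℂ → ℂ := fun z => ∑' k, qBinomCoeff q a k * z ^ k with hF
  have key : ∀ n : ℕ, (∏ i ∈ Finset.range n, (1 - (q : ℂ) ^ i * z)) * F z =
      (∏ i ∈ Finset.range n, (1 - (q : ℂ) ^ i * (a * z))) * F ((q : ℂ) ^ n * z) := by
    intro n
    induction n with
    | zero => simp
    | succ n ih =>
      have hz' : ‖(q : ℂ) ^ n * z‖ < 1 := by
        rw [norm_mul, norm_pow]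
        have := pow_le_one₀ (norm_nonneg (q : ℂ)) hn.le (n := n)
        nlinarith [norm_nonneg z]
      have h := tsum_qBinom_functional hq0 hq1 a hz'
      rw [← mul_assoc (q : ℂ), ← pow_succ'] at h
      change _ * F _ = _ * F _ at h
      rw [Finset.prod_range_succ, Finset.prod_range_succ]
      linear_combination (1 - (q : ℂ) ^ n * z) * ih +
        (∏ i ∈ Finset.range n, (1 - (q : ℂ) ^ i * (a * z))) * h
  have hlim : Tendsto (fun n : ℕ => F ((q : ℂ) ^ n * z)) atTop (𝓝 1) := by
    obtain ⟨M, hM⟩ := exists_norm_qBinomCoeff_le hq0 hq1 a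
    have h0 : (∑' k, qBinomCoeff q a k * (0 : ℂ) ^ k) = 1 := by
      rw [tsum_eq_single 0 (fun k hk => by simp [hk])]
      simp [qBinomCoeff]
    rw [← h0]
    refine tendsto_tsum_of_dominated_convergence (bound := fun k => M * ‖z‖ ^ k)
      ((summable_geometric_of_lt_one (norm_nonneg z) hz).mul_left M) (fun k => ?_)
      (Eventually.of_forall fun n k => ?_)
    · have : Tendsto (fun n : ℕ => (q : ℂ) ^ n * z) atTop (𝓝 0) := by
        simpa using (tendsto_pow_atTop_nhds_zero_of_norm_lt_one hn).mul_const z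
      exact (this.pow k).const_mul _
    · rw [norm_mul, norm_pow, norm_mul, norm_pow]
      have := pow_le_one₀ (norm_nonneg (q : ℂ)) hn.le (n := n)
      refine mul_le_mul (hM k) (pow_le_pow_left₀ (by positivity) ?_ k) (by positivity)
        ((norm_nonneg _).trans (hM 0))
      nlinarith [norm_nonneg z]
  have e := tendsto_nhds_unique
    (((tendsto_qPochInf hq0 hq1 z).mul_const (F z)).congr key)
    ((tendsto_qPochInf hq0 hq1 (a * z)).mul hlim)
  rw [eq_div_iff (qPochInf_ne_zero hq0 hq1 (pow_mul_ne_one hq0 hq1 hz))]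
  linear_combination e

/-- The `q`-beta integral, as a sum over the sample points. -/
lemma hasSum_qBeta (hq0 : 0 < q) (hq1 : q < 1) {b z : ℂ} (hb : ∀ i : ℕ, (q : ℂ) ^ i * b ≠ 1)
    (hz : ‖z‖ < 1) :
    HasSum (fun k : ℕ => z ^ k * (qPochInf q ((q : ℂ) ^ k * q) / qPochInf q ((q : ℂ) ^ k * b)))
      (qPochInf q q / qPochInf q b * (qPochInf q (b * z) / qPochInf q z)) := by
  have hn := norm_ofReal_lt_one hq0 hq1
  rw [← tsum_qBinom hq0 hq1 b hz]
  refine ((summable_qBinom hq0 hq1 b hz).hasSum.mul_left _).congr_fun fun k => ?_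
  have h1 := qPochInf_eq_prod_mul hq0 hq1 (q : ℂ) k
  have h2 := qPochInf_eq_prod_mul hq0 hq1 b k
  have n1 := qPochInf_ne_zero hq0 hq1 (pow_mul_ne_one hq0 hq1 hn)
  have n2 := qPochInf_ne_zero hq0 hq1 hb
  rw [h1] at n1
  rw [h2] at n2
  have a1 := left_ne_zero_of_mul n1
  have a2 := left_ne_zero_of_mul n2
  have a3 := right_ne_zero_of_mul n2
  rw [h1, h2, qBinomCoeff]
  generalize ∏ i ∈ Finset.range k, (1 - (q : ℂ) ^ i * q) = A at *
  generalize ∏ i ∈ Finset.range k, (1 - (q : ℂ) ^ i * b) = B at *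
  field_simp

end QSeries

section BetaDeterminant

open Polynomial in
lemma of_eval_eq_vandermonde_mul {R : Type*} [CommRing R] {n : ℕ} (v : Fin n → R)
    (p : Fin n → R[X]) (hp : ∀ j, (p j).natDegree < n) :
    Matrix.of (fun i j => (p j).eval (v i)) =
      Matrix.vandermonde v * Matrix.of fun i j : Fin n => (p j).coeff i := by
  ext i j
  simp only [Matrix.mul_apply, Matrix.of_apply, Matrix.vandermonde_apply]
  rw [eval_eq_sum_range' (hp j), ← Fin.sum_univ_eq_sum_range (fun k => (p j).coeff k * v i ^ k)]
  exact Finset.sum_congr rfl fun k _ => mul_comm _ _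

lemma prod_Iio_eq_prod_range {M : Type*} [CommMonoid M] {n : ℕ} (j : Fin n) (f : ℕ → M) :
    ∏ i ∈ Finset.Iio j, f i = ∏ t ∈ Finset.range j, f t := by
  have h := Fin.map_valEmbedding_Iio j
  have h2 : Finset.range (j : ℕ) = Finset.Iio (j : ℕ) := by ext; simp
  rw [h2, ← h, Finset.prod_map]
  rfl

lemma prod_Ioi_comm {M : Type*} [CommMonoid M] {n : ℕ} (f : Fin n → Fin n → M) :
    ∏ i, ∏ j ∈ Finset.Ioi i, f i j = ∏ j, ∏ i ∈ Finset.Iio j, f i j :=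
  Finset.prod_comm' (by simp)

open Polynomial in
/-- The determinant of the matrix of polynomials
`(B x Q^y; Q)_{n-1-y} (A x; Q)_y` at the points `X i`. -/
lemma det_pochhammer_pair {n : ℕ} {Q A : ℂ} (hA : A ≠ 0) (hQ : Q ≠ 0)
    (hQ1 : ∀ i : ℕ, Q ^ (i + 1) ≠ 1) (B : ℂ) (X : Fin n → ℂ) :
    (Matrix.of fun i y : Fin n =>
      (∏ t ∈ Finset.range (n - 1 - y), (1 - B * Q ^ ((y : ℕ) + t) * X i)) *
        ∏ t ∈ Finset.range y, (1 - A * Q ^ t * X i)).det =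
    (∏ i ∈ Finset.range n, ∏ t ∈ Finset.range i, ((1 - B / A * Q ^ t) * (A * Q ^ t))) *
      ∏ j, ∏ i ∈ Finset.Iio j, (X i - X j) := by
  set p : Fin n → ℂ[X] := fun y =>
    (∏ t ∈ Finset.range (n - 1 - y), (1 - C (B * Q ^ ((y : ℕ) + t)) * Polynomial.X)) *
      ∏ t ∈ Finset.range y, (1 - C (A * Q ^ t) * Polynomial.X) with hp
  have hdeg1 : ∀ c : ℂ, (1 - C c * Polynomial.X : ℂ[X]).natDegree ≤ 1 := fun c => by
    refine (natDegree_sub_le _ _).trans ?_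
    rw [natDegree_one]
    simpa using (natDegree_C_mul_le c Polynomial.X).trans natDegree_X_le
  have hdeg : ∀ (m : ℕ) (c : ℕ → ℂ),
      (∏ t ∈ Finset.range m, (1 - C (c t) * Polynomial.X)).natDegree ≤ m := fun m c => by
    refine (natDegree_prod_le _ _).trans ((Finset.sum_le_sum fun t _ => hdeg1 (c t)).trans ?_)
    simp
  have hpd : ∀ j, (p j).natDegree < n := fun j => by
    have h1 := hdeg (n - 1 - j) fun t => B * Q ^ ((j : ℕ) + t)
    have h2 := hdeg j fun t => A * Q ^ t
    have h3 := natDegree_mul_le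
      (p := ∏ t ∈ Finset.range (n - 1 - j), (1 - C (B * Q ^ ((j : ℕ) + t)) * Polynomial.X))
      (q := ∏ t ∈ Finset.range j, (1 - C (A * Q ^ t) * Polynomial.X))
    have := j.2
    simp only [hp]
    omega
  have heval : ∀ (Y : Fin n → ℂ), (Matrix.of fun i y : Fin n =>
      (∏ t ∈ Finset.range (n - 1 - y), (1 - B * Q ^ ((y : ℕ) + t) * Y i)) *
        ∏ t ∈ Finset.range y, (1 - A * Q ^ t * Y i)).det =
      (∏ j, ∏ i ∈ Finset.Iio j, (Y j - Y i)) *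
        (Matrix.of fun i j : Fin n => (p j).coeff i).det := fun Y => by
    rw [← prod_Ioi_comm fun i j => Y j - Y i, ← Matrix.det_vandermonde, ← Matrix.det_mul,
      ← of_eval_eq_vandermonde_mul Y p hpd]
    congr 1
    ext i y
    simp [hp, eval_prod]
  have hspec := heval fun i => (A * Q ^ (i : ℕ))⁻¹
  have hAQ : ∀ i : ℕ, A * Q ^ i ≠ 0 := fun i => mul_ne_zero hA (pow_ne_zero _ hQ)
  have hdiff : ∀ {t j : ℕ}, t < j → (1 : ℂ) - Q ^ t * (Q ^ j)⁻¹ ≠ 0 := by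
    intro t j htj h
    obtain ⟨k, rfl⟩ := Nat.exists_eq_add_of_lt htj
    apply hQ1 k
    have h' : Q ^ t * (Q ^ (t + k + 1))⁻¹ = 1 := (sub_eq_zero.1 h).symm
    rw [mul_inv_eq_one₀ (pow_ne_zero _ hQ), add_assoc, pow_add] at h'
    exact (mul_left_cancel₀ (pow_ne_zero t hQ) (by rw [mul_one]; exact h')).symm
  rw [Matrix.det_of_isLowerTriangular] at hspec
  swap
  · intro i j hij
    have hij : i < j := hij
    rw [Matrix.of_apply, Finset.prod_eq_zero (i := (i : ℕ)) (s := Finset.range (j : ℕ)) (by simpa),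
      mul_zero]
    rw [mul_inv_cancel₀ (hAQ i), sub_self]
  have hV : ∏ j : Fin n, ∏ i ∈ Finset.Iio j, ((A * Q ^ (j : ℕ))⁻¹ - (A * Q ^ (i : ℕ))⁻¹) =
      (∏ j : Fin n, ∏ t ∈ Finset.range j, (1 - A * Q ^ t * (A * Q ^ (j : ℕ))⁻¹)) *
        (∏ j : Fin n, ∏ t ∈ Finset.range j, (-(A * Q ^ t)))⁻¹ := by
    rw [← Finset.prod_inv_distrib, ← Finset.prod_mul_distrib]
    refine Finset.prod_congr rfl fun j _ => ?_
    rw [prod_Iio_eq_prod_range j fun i => (A * Q ^ (j : ℕ))⁻¹ - (A * Q ^ i)⁻¹,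
      ← Finset.prod_inv_distrib, ← Finset.prod_mul_distrib]
    refine Finset.prod_congr rfl fun t _ => ?_
    have h1 := hAQ j
    have h2 := hAQ t
    generalize A * Q ^ (j : ℕ) = a at *
    generalize A * Q ^ t = b at *
    field_simp
    ring
  have hD : (∏ j : Fin n, ∏ t ∈ Finset.range j, (1 - A * Q ^ t * (A * Q ^ (j : ℕ))⁻¹)) ≠ 0 := by
    refine Finset.prod_ne_zero_iff.2 fun j _ => Finset.prod_ne_zero_iff.2 fun t ht => ?_
    have := hdiff (Finset.mem_range.1 ht)
    rw [mul_inv, mul_mul_mul_comm, mul_inv_cancel₀ hA, one_mul]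
    exact this
  have hE : (∏ j : Fin n, ∏ t ∈ Finset.range j, (-(A * Q ^ t))) ≠ 0 :=
    Finset.prod_ne_zero_iff.2 fun j _ => Finset.prod_ne_zero_iff.2 fun t _ => neg_ne_zero.2 (hAQ t)
  simp only [Matrix.of_apply] at hspec
  rw [hV, Finset.prod_mul_distrib] at hspec
  have hrefl : ∏ i : Fin n, ∏ t ∈ Finset.range (n - 1 - i),
      (1 - B * Q ^ ((i : ℕ) + t) * (A * Q ^ (i : ℕ))⁻¹) =
      ∏ i : Fin n, ∏ t ∈ Finset.range i, (1 - B / A * Q ^ t) := by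
    rw [Fin.prod_univ_eq_prod_range (fun i => ∏ t ∈ Finset.range i, (1 - B / A * Q ^ t)),
      ← Finset.prod_range_reflect, ← Fin.prod_univ_eq_prod_range
        (fun i => ∏ t ∈ Finset.range (n - 1 - i), (1 - B / A * Q ^ t))]
    refine Finset.prod_congr rfl fun i _ => Finset.prod_congr rfl fun t _ => ?_
    have := pow_ne_zero (i : ℕ) hQ
    rw [pow_add]
    field_simp
  have hcoeff : (Matrix.of fun i j : Fin n => (p j).coeff i).det =
      (∏ i : Fin n, ∏ t ∈ Finset.range i, (1 - B / A * Q ^ t)) *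
        ∏ j : Fin n, ∏ t ∈ Finset.range j, (-(A * Q ^ t)) := by
    rw [← hrefl]
    generalize (Matrix.of fun i j : Fin n => (p j).coeff i).det = K at *
    generalize ∏ i : Fin n, ∏ t ∈ Finset.range (n - 1 - i),
      (1 - B * Q ^ ((i : ℕ) + t) * (A * Q ^ (i : ℕ))⁻¹) = a at *
    generalize (∏ j : Fin n, ∏ t ∈ Finset.range j, (1 - A * Q ^ t * (A * Q ^ (j : ℕ))⁻¹)) = b at *
    generalize (∏ j : Fin n, ∏ t ∈ Finset.range j, (-(A * Q ^ t))) = c at *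
    field_simp at hspec
    rw [← hspec]
  rw [heval, hcoeff,
    ← Fin.prod_univ_eq_prod_range
      (fun i => ∏ t ∈ Finset.range i, ((1 - B / A * Q ^ t) * (A * Q ^ t))), mul_comm]
  simp only [← Finset.prod_mul_distrib]
  refine Finset.prod_congr rfl fun j _ => ?_
  rw [← prod_Iio_eq_prod_range j fun t => (1 - B / A * Q ^ t) * -(A * Q ^ t),
    ← prod_Iio_eq_prod_range j fun t => (1 - B / A * Q ^ t) * (A * Q ^ t)]
  simp only [← Finset.prod_mul_distrib]
  refine Finset.prod_congr rfl fun i _ => ?_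
  ring

/-- The determinant of `q`-beta moments. -/
lemma det_qPochInf_ratio {Q : ℝ} (hQ0 : 0 < Q) (hQ1 : Q < 1) {n : ℕ} {A : ℂ} (hA : A ≠ 0) (B : ℂ)
    (x : Fin n → ℕ) (hx : ∀ i, qPochInf Q (A * (Q : ℂ) ^ x i) ≠ 0) :
    (Matrix.of fun i y : Fin n =>
      qPochInf Q (B * (Q : ℂ) ^ (x i + y)) / qPochInf Q (A * (Q : ℂ) ^ (x i + y))).det =
    (∏ i, qPochInf Q (B * (Q : ℂ) ^ (x i + (n - 1))) / qPochInf Q (A * (Q : ℂ) ^ x i)) *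
    ((∏ i ∈ Finset.range n, ∏ t ∈ Finset.range i,
        ((1 - B / A * (Q : ℂ) ^ t) * (A * (Q : ℂ) ^ t))) *
      ∏ j, ∏ i ∈ Finset.Iio j, ((Q : ℂ) ^ x i - (Q : ℂ) ^ x j)) := by
  have hQ : (Q : ℂ) ≠ 0 := by exact_mod_cast hQ0.ne'
  have hQn : ∀ i : ℕ, (Q : ℂ) ^ (i + 1) ≠ 1 := fun i => by
    have := (pow_lt_one₀ hQ0.le hQ1 i.succ_ne_zero).ne
    exact_mod_cast this
  rw [← det_pochhammer_pair hA hQ hQn B fun i => (Q : ℂ) ^ x i, ← Matrix.det_mul_column]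
  congr 1
  ext i y
  simp only [Matrix.of_apply]
  have h1 := qPochInf_eq_prod_mul hQ0 hQ1 (B * (Q : ℂ) ^ (x i + y)) (n - 1 - y)
  have h2 := qPochInf_eq_prod_mul hQ0 hQ1 (A * (Q : ℂ) ^ x i) y
  have e1 : (Q : ℂ) ^ (n - 1 - (y : ℕ)) * (B * (Q : ℂ) ^ (x i + y)) =
      B * (Q : ℂ) ^ (x i + (n - 1)) := by
    have : x i + (n - 1) = (n - 1 - (y : ℕ)) + (x i + y) := by have := y.2; omega
    rw [this, pow_add _ (n - 1 - (y : ℕ))]; ring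
  have e2 : (Q : ℂ) ^ (y : ℕ) * (A * (Q : ℂ) ^ x i) = A * (Q : ℂ) ^ (x i + y) := by
    rw [pow_add]; ring
  rw [e1] at h1
  rw [e2] at h2
  have h3 := hx i
  rw [h2] at h3
  have p1 : ∏ t ∈ Finset.range (n - 1 - y), (1 - (Q : ℂ) ^ t * (B * (Q : ℂ) ^ (x i + y))) =
      ∏ t ∈ Finset.range (n - 1 - y), (1 - B * (Q : ℂ) ^ ((y : ℕ) + t) * (Q : ℂ) ^ x i) :=
    Finset.prod_congr rfl fun t _ => by ring
  have p2 : ∏ t ∈ Finset.range (y : ℕ), (1 - (Q : ℂ) ^ t * (A * (Q : ℂ) ^ x i)) =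
      ∏ t ∈ Finset.range (y : ℕ), (1 - A * (Q : ℂ) ^ t * (Q : ℂ) ^ x i) :=
    Finset.prod_congr rfl fun t _ => by ring
  rw [p1] at h1
  rw [p2] at h2 h3
  have h4 := left_ne_zero_of_mul h3
  have h5 := right_ne_zero_of_mul h3
  rw [h1, h2]
  generalize ∏ t ∈ Finset.range (n - 1 - y), (1 - B * (Q : ℂ) ^ ((y : ℕ) + t) * (Q : ℂ) ^ x i) = a
  generalize ∏ t ∈ Finset.range (y : ℕ), (1 - A * (Q : ℂ) ^ t * (Q : ℂ) ^ x i) = b at *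
  field_simp

end BetaDeterminant

section SumsOfProducts

lemma summable_pi_prod_and_tsum_eq {N : ℕ} (f : Fin N → ℕ → ℂ) (hf : ∀ i, Summable (f i)) :
    Summable (fun k : Fin N → ℕ => ∏ i, f i (k i)) ∧
      ∑' k : Fin N → ℕ, ∏ i, f i (k i) = ∏ i, ∑' n, f i n := by
  induction N with
  | zero => exact ⟨(hasSum_fintype _).summable, by simp⟩
  | succ N ih =>
    obtain ⟨h1, h2⟩ := ih (fun i => f i.succ) fun i => hf i.succ
    have e : (fun k : Fin (N + 1) → ℕ => ∏ i, f i (k i)) ∘ Fin.consEquiv (fun _ => ℕ) =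
        fun p : ℕ × (Fin N → ℕ) => f 0 p.1 * ∏ i : Fin N, f i.succ (p.2 i) := by
      ext p
      simp [Fin.consEquiv, Fin.prod_univ_succ]
    have s := summable_mul_of_summable_norm (hf 0).norm h1.norm
    constructor
    · rw [← (Fin.consEquiv fun _ => ℕ).summable_iff, e]
      exact s
    · rw [← (Fin.consEquiv fun _ => ℕ).tsum_eq, Fin.prod_univ_succ, ← h2,
        (hf 0).tsum_mul_tsum h1 s]
      exact tsum_congr fun p => congrFun e p

lemma det_pow_eq_sum {N : ℕ} (x : Fin N → ℂ) (p : Fin N → ℕ) :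
    (Matrix.of fun i j : Fin N => x i ^ p j).det =
      ∑ σ : Equiv.Perm (Fin N), ((Equiv.Perm.sign σ : ℤ) : ℂ) * ∏ i, x i ^ p (σ i) := by
  rw [← Matrix.det_transpose, Matrix.det_apply']
  rfl

/-- The Andréief (Cauchy–Binet) identity, after the integrations have been carried out. -/
lemma sum_perm_perm_eq_det {N : ℕ} (f : ℕ → ℂ) (p s : Fin N → ℕ) :
    ∑ σ : Equiv.Perm (Fin N), ∑ τ : Equiv.Perm (Fin N),
      ((Equiv.Perm.sign σ : ℤ) : ℂ) * ((Equiv.Perm.sign τ : ℤ) : ℂ) * ∏ i, f (p (σ i) + s (τ i)) =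
    (N.factorial : ℂ) * (Matrix.of fun i j : Fin N => f (p i + s j)).det := by
  rw [Finset.sum_comm]
  have : ∀ τ : Equiv.Perm (Fin N), ∑ σ : Equiv.Perm (Fin N),
      ((Equiv.Perm.sign σ : ℤ) : ℂ) * ((Equiv.Perm.sign τ : ℤ) : ℂ) * ∏ i, f (p (σ i) + s (τ i)) =
      (Matrix.of fun i j : Fin N => f (p i + s j)).det := fun τ => by
    rw [Matrix.det_apply', ← Equiv.sum_comp (Equiv.mulRight τ)]
    refine Finset.sum_congr rfl fun σ _ => ?_
    have h : ((Equiv.Perm.sign τ : ℤ) : ℂ) * ((Equiv.Perm.sign τ : ℤ) : ℂ) = 1 := by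
      rw [← Int.cast_mul, ← Units.val_mul, Int.units_mul_self]; simp
    rw [← Equiv.prod_comp τ fun i => (Matrix.of fun i j : Fin N => f (p i + s j)) (σ i) i]
    simp only [Equiv.coe_mulRight, Equiv.Perm.sign_mul, Units.val_mul, Int.cast_mul,
      Matrix.of_apply, Equiv.Perm.mul_apply]
    linear_combination (((Equiv.Perm.sign σ : ℤ) : ℂ) * ∏ i, f (p (σ (τ i)) + s (τ i))) * h
  simp [this, Fintype.card_perm]

end SumsOfProducts

section Moments

variable {q : ℝ} {r a : ℕ} {u v : ℂ}

lemma ofReal_pow_cpow (hq0 : 0 < q) (r : ℕ) (z : ℂ) :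
    ((q ^ r : ℝ) : ℂ) ^ z = (q : ℂ) ^ ((r : ℂ) * z) := by
  have h1 : ((q ^ r : ℝ) : ℂ) ≠ 0 := by exact_mod_cast (pow_pos hq0 r).ne'
  have h2 : (q : ℂ) ≠ 0 := by exact_mod_cast hq0.ne'
  rw [Complex.cpow_def_of_ne_zero h1, Complex.cpow_def_of_ne_zero h2, ← Complex.ofReal_log
    (pow_pos hq0 r).le, ← Complex.ofReal_log hq0.le, Real.log_pow]
  push_cast
  ring_nf

/-- The weight `x^{ru} (q^r x^r; q^r)_v / 2π` of one integration variable. -/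
noncomputable def rayWeight (q : ℝ) (r : ℕ) (u v x : ℂ) : ℂ :=
  1 / (2 * (Real.pi : ℂ)) * (x ^ r) ^ u * qPoch (q ^ r) ((q : ℂ) ^ r * x ^ r) v

/-- The moment `∫_0^1 x^m (x^r)^u (q^r x^r; q^r)_v d_q x / 2π`. -/
noncomputable def rayMoment (q : ℝ) (r : ℕ) (u v : ℂ) (m : ℕ) : ℂ :=
  (1 - (q : ℂ)) / (2 * (Real.pi : ℂ)) *
    (qPochInf (q ^ r) ((q ^ r : ℝ) : ℂ) / qPochInf (q ^ r) ((q ^ r : ℝ) ^ (v + 1)) *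
      (qPochInf (q ^ r) ((q ^ r : ℝ) ^ (v + 1) * (q : ℂ) ^ ((m : ℂ) + 1 + r * u)) /
        qPochInf (q ^ r) ((q : ℂ) ^ ((m : ℂ) + 1 + r * u))))

/-- The moment over the contour `C_{r,a}`. -/
noncomputable def moment (q : ℝ) (r a : ℕ) (u v : ℂ) (m : ℕ) : ℂ :=
  if m + 1 ≡ a [MOD r] then r * rayMoment q r u v m else 0

lemma rayWeight_sample (hq0 : 0 < q) {w : ℂ} (hw : w ^ r = 1) (k : ℕ) :
    rayWeight q r u v ((q : ℂ) ^ k * w) =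
      1 / (2 * (Real.pi : ℂ)) * ((q : ℂ) ^ ((r : ℂ) * u)) ^ k *
        (qPochInf (q ^ r) (((q ^ r : ℝ) : ℂ) ^ k * ((q ^ r : ℝ) : ℂ)) /
          qPochInf (q ^ r) (((q ^ r : ℝ) : ℂ) ^ k * ((q ^ r : ℝ) : ℂ) ^ (v + 1))) := by
  have h1 : ((q : ℂ) ^ k * w) ^ r = ((q ^ (k * r) : ℝ) : ℂ) := by
    rw [mul_pow, hw, mul_one, ← pow_mul]; push_cast; rfl
  have hQ : ((q ^ r : ℝ) : ℂ) ≠ 0 := by exact_mod_cast (pow_pos hq0 r).ne'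
  have h2 : (q : ℂ) ^ r * ((q ^ (k * r) : ℝ) : ℂ) =
      ((q ^ r : ℝ) : ℂ) ^ k * ((q ^ r : ℝ) : ℂ) := by
    push_cast; rw [← pow_mul, mul_comm, mul_comm r k]
  rw [rayWeight, h1, ofReal_pow_cpow hq0, h2, qPoch, Nat.cast_mul, mul_assoc (k : ℂ),
    Complex.cpow_nat_mul, Complex.cpow_add _ _ hQ, Complex.cpow_one]
  congr 3
  ring_nf

lemma hasSum_ray (hq0 : 0 < q) (hq1 : q < 1) (hr : 0 < r) (hu : -1 < (r : ℝ) * u.re)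
    (hv : ∀ n : ℕ, (q : ℂ) ^ ((r : ℂ) * (v + n + 1)) ≠ 1) {w : ℂ} (hw : w ^ r = 1) (m : ℕ) :
    HasSum (fun k : ℕ => (1 - (q : ℂ)) * w * (q : ℂ) ^ k *
        (rayWeight q r u v ((q : ℂ) ^ k * w) * ((q : ℂ) ^ k * w) ^ m))
      (w ^ (m + 1) * rayMoment q r u v m) := by
  have hq : (q : ℂ) ≠ 0 := by exact_mod_cast hq0.ne'
  have hb : ∀ i : ℕ, ((q ^ r : ℝ) : ℂ) ^ i * ((q ^ r : ℝ) : ℂ) ^ (v + 1) ≠ 1 := fun i => by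
    have hQ : ((q ^ r : ℝ) : ℂ) ≠ 0 := by exact_mod_cast (pow_pos hq0 r).ne'
    rw [← Complex.cpow_natCast, ← Complex.cpow_add _ _ hQ, ofReal_pow_cpow hq0]
    convert hv i using 3
    ring
  have hz : ‖(q : ℂ) ^ ((m : ℂ) + 1 + r * u)‖ < 1 := by
    rw [Complex.norm_cpow_eq_rpow_re_of_pos hq0]
    apply Real.rpow_lt_one hq0.le hq1
    have := m.cast_nonneg (α := ℝ)
    simp
    linarith
  have h := (hasSum_qBeta (pow_pos hq0 r) (pow_lt_one₀ hq0.le hq1 hr.ne') hb hz).mul_left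
    (w ^ (m + 1) * ((1 - (q : ℂ)) / (2 * (Real.pi : ℂ))))
  rw [rayMoment, ← mul_assoc (w ^ (m + 1))]
  refine h.congr_fun fun k => ?_
  rw [rayWeight_sample hq0 hw, Complex.cpow_add _ _ hq, Complex.cpow_add _ _ hq,
    Complex.cpow_natCast, Complex.cpow_one]
  generalize (qPochInf (q ^ r) (((q ^ r : ℝ) : ℂ) ^ k * ((q ^ r : ℝ) : ℂ)) /
          qPochInf (q ^ r) (((q ^ r : ℝ) : ℂ) ^ k * ((q ^ r : ℝ) : ℂ) ^ (v + 1))) = A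
  ring

lemma omega_pow (hr : 0 < r) : omega r ^ r = 1 :=
  (Complex.isPrimitiveRoot_exp r hr.ne').pow_eq_one

lemma sum_omega (hr : 0 < r) (a m : ℕ) :
    ∑ j : Fin r, (omega r ^ ((j : ℕ) * a))⁻¹ * (omega r ^ (j : ℕ)) ^ m =
      if m ≡ a [MOD r] then (r : ℂ) else 0 := by
  have hp : IsPrimitiveRoot (omega r) r := Complex.isPrimitiveRoot_exp r hr.ne'
  have h0 : omega r ≠ 0 := hp.ne_zero hr.ne'
  have e : ∀ j : Fin r, (omega r ^ ((j : ℕ) * a))⁻¹ * (omega r ^ (j : ℕ)) ^ m =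
      (omega r ^ ((m : ℤ) - a)) ^ (j : ℕ) := fun j => by
    rw [zpow_sub₀ h0, zpow_natCast, zpow_natCast, div_pow, ← pow_mul, ← pow_mul, ← pow_mul,
      mul_comm a, mul_comm m, div_eq_inv_mul]
  have h1 : omega r ^ ((m : ℤ) - a) = 1 ↔ m ≡ a [MOD r] := by
    rw [hp.zpow_eq_one_iff_dvd, Nat.ModEq.comm, Nat.modEq_iff_dvd]
  simp only [e]
  rw [Fin.sum_univ_eq_sum_range fun j => (omega r ^ ((m : ℤ) - a)) ^ j]
  split_ifs with h
  · rw [h1.2 h]; simp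
  · rw [geom_sum_eq (mt h1.1 h), ← zpow_natCast, zpow_comm, zpow_natCast, omega_pow hr]
    simp

end Moments

section Model

variable {q : ℝ} {r a N : ℕ} {u v : ℂ}

/-- The integrand obtained from two alternants with exponents `p` and `s`. -/
noncomputable def alternantIntegrand (q : ℝ) (r : ℕ) (u v : ℂ) (p s : Fin N → ℕ)
    (x : Fin N → ℂ) : ℂ :=
  (Matrix.of fun i j : Fin N => x i ^ p j).det * (Matrix.of fun i j : Fin N => x i ^ s j).det *
    ∏ i, rayWeight q r u v (x i)

lemma alternantIntegrand_eq_sum (p s : Fin N → ℕ) (x : Fin N → ℂ) :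
    alternantIntegrand q r u v p s x =
      ∑ σ : Equiv.Perm (Fin N), ∑ τ : Equiv.Perm (Fin N),
        ((Equiv.Perm.sign σ : ℤ) : ℂ) * ((Equiv.Perm.sign τ : ℤ) : ℂ) *
          ∏ i, (rayWeight q r u v (x i) * x i ^ (p (σ i) + s (τ i))) := by
  rw [alternantIntegrand, det_pow_eq_sum, det_pow_eq_sum, Finset.sum_mul_sum, Finset.sum_mul]
  refine Finset.sum_congr rfl fun σ _ => ?_
  rw [Finset.sum_mul]
  refine Finset.sum_congr rfl fun τ _ => ?_
  simp only [pow_add, Finset.prod_mul_distrib]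
  ring

lemma hasSum_jacksonTerm_alternant (hq0 : 0 < q) (hq1 : q < 1) (hr : 0 < r)
    (hu : -1 < (r : ℝ) * u.re) (hv : ∀ n : ℕ, (q : ℂ) ^ ((r : ℂ) * (v + n + 1)) ≠ 1)
    (p s : Fin N → ℕ) (j : Fin N → Fin r) :
    HasSum (jacksonTerm q (rayEnd r j) (alternantIntegrand q r u v p s))
      (∑ σ : Equiv.Perm (Fin N), ∑ τ : Equiv.Perm (Fin N),
        ((Equiv.Perm.sign σ : ℤ) : ℂ) * ((Equiv.Perm.sign τ : ℤ) : ℂ) *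
          ∏ i, ((omega r ^ (j i : ℕ)) ^ (p (σ i) + s (τ i) + 1) *
            rayMoment q r u v (p (σ i) + s (τ i)))) := by
  have hw : ∀ i, (omega r ^ (j i : ℕ)) ^ r = 1 := fun i => by
    rw [← pow_mul, mul_comm, pow_mul, omega_pow hr, one_pow]
  have e : jacksonTerm q (rayEnd r j) (alternantIntegrand q r u v p s) = fun k : Fin N → ℕ =>
      ∑ σ : Equiv.Perm (Fin N), ∑ τ : Equiv.Perm (Fin N),
        ((Equiv.Perm.sign σ : ℤ) : ℂ) * ((Equiv.Perm.sign τ : ℤ) : ℂ) *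
          ∏ i, ((1 - (q : ℂ)) * omega r ^ (j i : ℕ) * (q : ℂ) ^ k i *
            (rayWeight q r u v ((q : ℂ) ^ k i * omega r ^ (j i : ℕ)) *
              ((q : ℂ) ^ k i * omega r ^ (j i : ℕ)) ^ (p (σ i) + s (τ i)))) := by
    ext k
    rw [jacksonTerm, alternantIntegrand_eq_sum, Finset.mul_sum]
    refine Finset.sum_congr rfl fun σ _ => ?_
    rw [Finset.mul_sum]
    refine Finset.sum_congr rfl fun τ _ => ?_
    rw [Finset.prod_mul_distrib (s := Finset.univ)
      (f := fun i => (1 - (q : ℂ)) * omega r ^ (j i : ℕ) * (q : ℂ) ^ k i)]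
    simp only [rayEnd]
    ring
  rw [e]
  refine hasSum_sum fun σ _ => hasSum_sum fun τ _ => HasSum.mul_left _ ?_
  have hs := fun i => hasSum_ray hq0 hq1 hr hu hv (hw i) (p (σ i) + s (τ i))
  obtain ⟨h1, h2⟩ := summable_pi_prod_and_tsum_eq _ fun i => (hs i).summable
  have h3 := h1.hasSum
  rw [h2] at h3
  simpa only [(hs _).tsum_eq] using h3

lemma contourIntegral_alternant (hq0 : 0 < q) (hq1 : q < 1) (hr : 0 < r)
    (hu : -1 < (r : ℝ) * u.re) (hv : ∀ n : ℕ, (q : ℂ) ^ ((r : ℂ) * (v + n + 1)) ≠ 1)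
    (p s : Fin N → ℕ) :
    contourIntegral q r a (alternantIntegrand q r u v p s) =
      (N.factorial : ℂ) * (Matrix.of fun i j : Fin N => moment q r a u v (p i + s j)).det := by
  rw [← sum_perm_perm_eq_det, contourIntegral]
  simp only [jacksonIntegral, (hasSum_jacksonTerm_alternant hq0 hq1 hr hu hv p s _).tsum_eq,
    Finset.mul_sum]
  rw [Finset.sum_comm]
  refine Finset.sum_congr rfl fun σ _ => ?_
  rw [Finset.sum_comm]
  refine Finset.sum_congr rfl fun τ _ => ?_
  have e : ∀ i, moment q r a u v (p (σ i) + s (τ i)) = ∑ j : Fin r,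
      (omega r ^ ((j : ℕ) * a))⁻¹ * ((omega r ^ (j : ℕ)) ^ (p (σ i) + s (τ i) + 1) *
        rayMoment q r u v (p (σ i) + s (τ i))) := fun i => by
    simp only [← mul_assoc]
    rw [← Finset.sum_mul, sum_omega hr, moment]
    split_ifs <;> simp
  simp only [e]
  rw [Finset.prod_univ_sum, Finset.mul_sum, Fintype.piFinset_univ]
  refine Finset.sum_congr rfl fun j _ => ?_
  simp only [Finset.prod_mul_distrib]
  ring

lemma det_alternant_sq (x : Fin N → ℂ) :
    (Matrix.of fun i j : Fin N => x i ^ (N - ((j : ℕ) + 1))).det *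
      (Matrix.of fun i j : Fin N => x i ^ (N - ((j : ℕ) + 1))).det =
      ∏ i, ∏ j ∈ Finset.Ioi i, (x i - x j) ^ 2 := by
  have h : (Matrix.of fun i j : Fin N => x i ^ (N - ((j : ℕ) + 1))) =
      Matrix.projVandermonde (fun _ => (1 : ℂ)) x := by
    ext i j
    rw [Matrix.projVandermonde_apply, one_pow, one_mul, Fin.val_rev]
    rfl
  rw [h, Matrix.det_projVandermonde, ← Finset.prod_mul_distrib]
  refine Finset.prod_congr rfl fun i _ => ?_
  rw [← Finset.prod_mul_distrib]
  refine Finset.prod_congr rfl fun j _ => ?_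
  ring

/-- The strictly decreasing exponents `l_i + N - 1 - i`. -/
def betaSet (N : ℕ) (l : YoungDiagram) (i : ℕ) : ℕ := N - (i + 1) + l.rowLen i

lemma integrand_schur (l : YoungDiagram) :
    integrand q r u v (schur l) = alternantIntegrand (N := N) q r u v
      (fun j => betaSet N l j) fun j => N - ((j : ℕ) + 1) := by
  ext x
  rw [integrand, alternantIntegrand, ← det_alternant_sq, schur]
  change _ * (∏ i, rayWeight q r u v (x i)) * _ = _
  simp only [betaSet]
  by_cases h : (Matrix.of fun i j : Fin N => x i ^ (N - ((j : ℕ) + 1))).det = 0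
  · rw [h]; simp
  · field_simp

lemma rowLen_bot (i : ℕ) : (⊥ : YoungDiagram).rowLen i = 0 := by
  by_contra h
  exact YoungDiagram.notMem_bot _ (YoungDiagram.mem_iff_lt_rowLen.2 (Nat.pos_of_ne_zero h))

lemma integrand_one :
    integrand (N := N) q r u v (fun _ => 1) = alternantIntegrand q r u v
      (fun j => betaSet N ⊥ j) fun j => N - ((j : ℕ) + 1) := by
  ext x
  rw [integrand, alternantIntegrand, ← det_alternant_sq]
  change _ * (∏ i, rayWeight q r u v (x i)) * _ = _
  simp only [betaSet, rowLen_bot, add_zero]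
  ring

/-- The matrix of moments whose determinant is the average of a Schur polynomial. -/
noncomputable def momentDet (q : ℝ) (r a : ℕ) (u v : ℂ) (N : ℕ) (l : YoungDiagram) : ℂ :=
  (Matrix.of fun i j : Fin N =>
    moment q r a u v (betaSet N l i + (N - ((j : ℕ) + 1)))).det

lemma ZIns_schur (hq0 : 0 < q) (hq1 : q < 1) (hr : 0 < r)
    (hu : -1 < (r : ℝ) * u.re) (hv : ∀ n : ℕ, (q : ℂ) ^ ((r : ℂ) * (v + n + 1)) ≠ 1)
    (l : YoungDiagram) :
    ZIns q r a u v N (schur l) = momentDet q r a u v N l := by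
  rw [ZIns, integrand_schur, contourIntegral_alternant hq0 hq1 hr hu hv, momentDet]
  have : (N.factorial : ℂ) ≠ 0 := by exact_mod_cast N.factorial_ne_zero
  field_simp

lemma Z_eq_momentDet (hq0 : 0 < q) (hq1 : q < 1) (hr : 0 < r)
    (hu : -1 < (r : ℝ) * u.re) (hv : ∀ n : ℕ, (q : ℂ) ^ ((r : ℂ) * (v + n + 1)) ≠ 1) :
    Z q r a u v N = momentDet q r a u v N ⊥ := by
  rw [Z, ZIns, integrand_one, contourIntegral_alternant hq0 hq1 hr hu hv, momentDet]
  have : (N.factorial : ℂ) ≠ 0 := by exact_mod_cast N.factorial_ne_zero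
  field_simp

end Model

section ResidueArithmetic

/-- The distance from `P + 1` to the next integer congruent to `a`. -/
def gapTo (r a P : ℕ) : ℕ := (a + (r - 1 - P % r)) % r

/-- The least integer above `P` congruent to `a` modulo `r`. -/
def nextCongr (r a P : ℕ) : ℕ := P + 1 + gapTo r a P

/-- The involution `r y + ν ↦ r y + (a - 1 - ν mod r)`. -/
def classFlip (r a j : ℕ) : ℕ := r * (j / r) + gapTo r a j

/-- The number of integers in `[0, N)` congruent to `ν` modulo `r`. -/
def classCard (r N ν : ℕ) : ℕ := (N + (r - 1 - ν)) / r

variable {r a N : ℕ}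

lemma gapTo_lt (hr : 0 < r) (P : ℕ) : gapTo r a P < r := Nat.mod_lt _ hr

lemma gapTo_eq (ha : a < r) (P : ℕ) :
    gapTo r a P = if P % r < a then a - 1 - P % r else a + (r - 1 - P % r) := by
  have h := Nat.mod_lt P (by omega : 0 < r)
  rw [gapTo]
  split_ifs with h1
  · rw [Nat.mod_eq_sub_mod (by omega), Nat.mod_eq_of_lt (by omega)]
    omega
  · rw [Nat.mod_eq_of_lt (by omega)]

lemma gapTo_congr {P P' : ℕ} (h : P % r = P' % r) : gapTo r a P = gapTo r a P' := by
  rw [gapTo, gapTo, h]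

lemma nextCongr_modEq (ha : a < r) (P : ℕ) : nextCongr r a P % r = a := by
  have hP := Nat.div_add_mod P r
  have h := Nat.mod_lt P (by omega : 0 < r)
  rw [nextCongr, gapTo_eq ha]
  split_ifs with h1
  · have : P + 1 + (a - 1 - P % r) = a + r * (P / r) := by omega
    rw [this, Nat.add_mul_mod_self_left, Nat.mod_eq_of_lt ha]
  · have : P + 1 + (a + (r - 1 - P % r)) = a + r * (P / r + 1) := by
      rw [mul_add, mul_one]; omega
    rw [this, Nat.add_mul_mod_self_left, Nat.mod_eq_of_lt ha]

lemma nextCongr_eq_add (r a P : ℕ) : nextCongr r a P = nextCongr r a (P % r) + r * (P / r) := by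
  have hP := Nat.div_add_mod P r
  have : gapTo r a P = gapTo r a (P % r) := gapTo_congr (Nat.mod_mod _ _).symm
  rw [nextCongr, nextCongr, this]
  omega

lemma classFlip_div (hr : 0 < r) (j : ℕ) : classFlip r a j / r = j / r := by
  rw [classFlip, Nat.mul_add_div hr, Nat.div_eq_of_lt (gapTo_lt hr j), add_zero]

lemma classFlip_mod (hr : 0 < r) (j : ℕ) : classFlip r a j % r = gapTo r a j := by
  rw [classFlip, Nat.mul_add_mod, Nat.mod_eq_of_lt (gapTo_lt hr j)]

lemma classFlip_classFlip (ha : a < r) (j : ℕ) : classFlip r a (classFlip r a j) = j := by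
  have hr : 0 < r := by omega
  have hj := Nat.div_add_mod j r
  have h := Nat.mod_lt j hr
  rw [classFlip, classFlip_div hr, gapTo_eq ha, classFlip_mod hr, gapTo_eq ha]
  split_ifs <;> omega

lemma classFlip_lt (ha : a < r) (hN : N % r = 0 ∨ N % r = a) {j : ℕ} (hj : j < N) :
    classFlip r a j < N := by
  have hr : 0 < r := by omega
  have hjd := Nat.div_add_mod j r
  have hNd := Nat.div_add_mod N r
  have h := Nat.mod_lt j hr
  have h2 := gapTo_lt (a := a) hr j
  have hle : j / r ≤ N / r := Nat.div_le_div_right hj.le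
  rcases hle.lt_or_eq with hlt | heq
  · have : r * (j / r + 1) ≤ r * (N / r) := Nat.mul_le_mul_left r hlt
    rw [mul_add, mul_one] at this
    rw [classFlip]
    omega
  · rw [classFlip, gapTo_eq ha, heq]
    rw [heq] at hjd
    split_ifs <;> omega

lemma lt_classCard_iff (hr : 0 < r) {ν : ℕ} (hν : ν < r) (y : ℕ) :
    y < classCard r N ν ↔ r * y + ν < N := by
  rw [classCard, Nat.lt_iff_add_one_le, Nat.le_div_iff_mul_le hr, add_mul, mul_comm y]
  omega

lemma classCard_eq (hr : 0 < r) {ν : ℕ} (hν : ν < r) :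
    classCard r N ν = N / r + if ν < N % r then 1 else 0 := by
  have hNd := Nat.div_add_mod N r
  have := Nat.mod_lt N hr
  rw [classCard]
  conv_lhs => rw [← hNd, add_assoc, Nat.mul_add_div hr]
  split_ifs with h1
  · rw [Nat.div_eq_of_lt_le (m := N % r + (r - 1 - ν)) (k := 1) (by omega) (by omega)]
  · rw [Nat.div_eq_of_lt (a := N % r + (r - 1 - ν)) (by omega)]

lemma mul_classCard (ha : a < r) (hN : N % r = 0 ∨ N % r = a) (P : ℕ) :
    nextCongr r a P + r * classCard r N (P % r) = nextCongr r a (P + N) := by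
  have hr : 0 < r := by omega
  have hP := Nat.div_add_mod P r
  have hNd := Nat.div_add_mod N r
  have h := Nat.mod_lt P hr
  have hc := classCard_eq (N := N) hr h
  have hm : (P + N) % r = if P % r + N % r < r then P % r + N % r else P % r + N % r - r := by
    rw [Nat.add_mod]
    split_ifs with h1
    · exact Nat.mod_eq_of_lt h1
    · rw [Nat.mod_eq_sub_mod (by omega), Nat.mod_eq_of_lt (by omega)]
  rw [hc, nextCongr, nextCongr, gapTo_eq ha, gapTo_eq ha, hm, mul_add]
  rcases hN with h0 | h0 <;> simp only [h0] at * <;> split_ifs <;> omega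

@[to_additive]
lemma prod_range_eq_prod_classes {M : Type*} [CommMonoid M] (hr : 0 < r) (N : ℕ) (f : ℕ → M) :
    ∏ j ∈ Finset.range N, f j =
      ∏ ν : Fin r, ∏ y ∈ Finset.range (classCard r N ν), f (r * y + ν) := by
  rw [Finset.prod_sigma']
  refine Finset.prod_nbij' (fun j => ⟨⟨j % r, Nat.mod_lt _ hr⟩, j / r⟩)
    (fun p => r * p.2 + p.1) ?_ ?_ ?_ ?_ ?_
  · intro j hj
    have := Nat.div_add_mod j r
    simp only [Finset.mem_sigma, Finset.mem_univ, true_and, Finset.mem_range] at hj ⊢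
    rw [lt_classCard_iff hr (Nat.mod_lt _ hr)]
    omega
  · rintro ⟨ν, y⟩ h
    simp only [Finset.mem_sigma, Finset.mem_univ, true_and, Finset.mem_range] at h ⊢
    exact (lt_classCard_iff hr ν.2 y).1 h
  · intro j _
    exact Nat.div_add_mod j r
  · rintro ⟨ν, y⟩ _
    have h1 : (r * y + ν) % r = ν := by rw [Nat.mul_add_mod, Nat.mod_eq_of_lt ν.2]
    have h2 : (r * y + ν) / r = y := by
      rw [Nat.mul_add_div hr, Nat.div_eq_of_lt ν.2, add_zero]
    simp only [h1, h2]
  · intro j _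
    simp only [Nat.div_add_mod]

/-- The positions of a residue class in `[0, N)`. -/
def classEquiv (hr : 0 < r) (N : ℕ) (ν : Fin r) :
    Fin (classCard r N ν) ≃ {i : Fin N // (⟨i % r, Nat.mod_lt _ hr⟩ : Fin r) = ν} where
  toFun y := ⟨⟨r * y + ν, (lt_classCard_iff hr ν.2 y).1 y.2⟩, by
    ext; simp [Nat.mod_eq_of_lt ν.2]⟩
  invFun i := ⟨i.1 / r, by
    have h1 : (i.1 : ℕ) % r = ν := congrArg Fin.val i.2
    have h2 := Nat.div_add_mod (i.1 : ℕ) r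
    rw [lt_classCard_iff hr ν.2]
    have := i.1.2
    omega⟩
  left_inv y := by
    ext; simp [Nat.mul_add_div hr, Nat.div_eq_of_lt ν.2]
  right_inv i := by
    ext
    have h1 : (i.1 : ℕ) % r = ν := congrArg Fin.val i.2
    have h2 := Nat.div_add_mod (i.1 : ℕ) r
    simp only
    omega

end ResidueArithmetic

section ClassSign

variable {r a N : ℕ}

/-- The involution `classFlip` as a permutation of `[0, N)`. -/
def flipPerm (ha : a < r) (hN : N % r = 0 ∨ N % r = a) : Equiv.Perm (Fin N) where
  toFun j := ⟨classFlip r a j, classFlip_lt ha hN j.2⟩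
  invFun j := ⟨classFlip r a j, classFlip_lt ha hN j.2⟩
  left_inv j := Fin.ext (classFlip_classFlip ha j)
  right_inv j := Fin.ext (classFlip_classFlip ha j)

/-- The number of inversions of `classFlip` below an index of residue `ν`. -/
def flipInv (a ν : ℕ) : ℕ := if ν < a then ν else ν - a

lemma prod_flip_inversions (ha : a < r) (j : ℕ) :
    ∏ i ∈ Finset.range j, (if classFlip r a i < classFlip r a j then (1 : ℤ) else -1) =
      (-1) ^ flipInv a (j % r) := by
  have hr : 0 < r := by omega
  have hj := Nat.div_add_mod j r
  have hjr := Nat.mod_lt j hr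
  have e1 : ∀ i ∈ Finset.range (r * (j / r)),
      (if classFlip r a i < classFlip r a j then (1 : ℤ) else -1) = 1 := fun i hi => by
    have hi : i / r < j / r := by
      rw [Nat.div_lt_iff_lt_mul hr, mul_comm]; exact Finset.mem_range.1 hi
    have h1 : r * (i / r + 1) ≤ r * (j / r) := Nat.mul_le_mul_left r hi
    have := gapTo_lt (a := a) hr i
    rw [mul_add, mul_one] at h1
    rw [if_pos]
    rw [classFlip, classFlip]
    omega
  have e2 : ∀ ν < j % r,
      (if classFlip r a (r * (j / r) + ν) < classFlip r a j then (1 : ℤ) else -1) =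
        if ν < a ∧ a ≤ j % r then 1 else -1 := fun ν hν => by
    have h1 : (r * (j / r) + ν) / r = j / r := by
      rw [Nat.mul_add_div hr, Nat.div_eq_of_lt (hν.trans hjr), add_zero]
    have h2 : (r * (j / r) + ν) % r = ν := by
      rw [Nat.mul_add_mod, Nat.mod_eq_of_lt (by omega)]
    rw [classFlip, classFlip, h1, gapTo_eq ha, gapTo_eq ha, h2]
    congr 1
    split_ifs <;> simp <;> omega
  have e3 : ∏ i ∈ Finset.range j, (if classFlip r a i < classFlip r a j then (1 : ℤ) else -1) =
      ∏ ν ∈ Finset.range (j % r), if ν < a ∧ a ≤ j % r then (1 : ℤ) else -1 := by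
    conv_lhs => rw [← hj]
    rw [Finset.prod_range_add, hj, Finset.prod_eq_one e1, one_mul]
    exact Finset.prod_congr rfl fun ν hν => e2 ν (Finset.mem_range.1 hν)
  rw [e3, flipInv]
  split_ifs with h
  · rw [Finset.prod_congr rfl fun ν _ => if_neg (by omega)]
    simp
  · have : j % r = a + (j % r - a) := by omega
    conv_lhs => rw [this]
    rw [Finset.prod_range_add, Finset.prod_eq_one (fun ν hν => if_pos
        ⟨Finset.mem_range.1 hν, by omega⟩), one_mul,
      Finset.prod_congr rfl fun ν _ => if_neg (by omega)]
    simp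

lemma prod_neg_one_pow_range (n : ℕ) :
    ∏ ν ∈ Finset.range n, (-1 : ℤ) ^ ν = (-1) ^ (n * (n - 1) / 2) := by
  rw [Finset.prod_pow_eq_pow_sum, Finset.sum_range_id]

lemma sign_flipPerm (ha : a < r) (hN : N % r = 0 ∨ N % r = a) :
    ((Equiv.Perm.sign (flipPerm ha hN) : ℤˣ) : ℤ) = deltaN r a N := by
  have hr : 0 < r := by omega
  have hNd := Nat.div_add_mod N r
  have e1 : ∏ ν ∈ Finset.range a, (-1 : ℤ) ^ flipInv a ν = (-1) ^ (a * (a - 1) / 2) := by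
    rw [← prod_neg_one_pow_range]
    refine Finset.prod_congr rfl fun ν hν => ?_
    rw [flipInv, if_pos (Finset.mem_range.1 hν)]
  have e2 : ∏ ν ∈ Finset.range r, (-1 : ℤ) ^ flipInv a ν =
      (-1) ^ (a * (a - 1) / 2) * (-1) ^ ((r - a) * (r - a - 1) / 2) := by
    have : r = a + (r - a) := by omega
    conv_lhs => rw [this]
    rw [Finset.prod_range_add, e1, ← prod_neg_one_pow_range (r - a)]
    congr 1
    refine Finset.prod_congr rfl fun ν _ => ?_
    rw [flipInv, if_neg (by omega), Nat.add_sub_cancel_left]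
  have e3 : ∀ k, ∏ j ∈ Finset.range (r * k), (-1 : ℤ) ^ flipInv a (j % r) =
      ((-1) ^ (a * (a - 1) / 2) * (-1) ^ ((r - a) * (r - a - 1) / 2)) ^ k := fun k => by
    induction k with
    | zero => simp
    | succ k ih =>
      rw [mul_add, mul_one, Finset.prod_range_add, ih, pow_succ, ← e2]
      congr 1
      refine Finset.prod_congr rfl fun ν hν => ?_
      rw [Nat.mul_add_mod, Nat.mod_eq_of_lt (Finset.mem_range.1 hν)]
  have e4 : ((Equiv.Perm.sign (flipPerm ha hN) : ℤˣ) : ℤ) =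
      ∏ j ∈ Finset.range N, (-1 : ℤ) ^ flipInv a (j % r) := by
    rw [Equiv.Perm.sign_eq_prod_prod_Iio,
      ← Fin.prod_univ_eq_prod_range fun j => (-1 : ℤ) ^ flipInv a (j % r)]
    push_cast
    refine Finset.prod_congr rfl fun j _ => ?_
    rw [← prod_flip_inversions ha, ← prod_Iio_eq_prod_range j
      fun i => if classFlip r a i < classFlip r a j then (1 : ℤ) else -1]
    refine Finset.prod_congr rfl fun i _ => ?_
    have : flipPerm ha hN i < flipPerm ha hN j ↔ classFlip r a i < classFlip r a j := Iff.rfl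
    simp only [this]
    split_ifs <;> simp
  rw [e4, deltaN, if_pos hN]
  conv_lhs => rw [← hNd]
  rw [Finset.prod_range_add, e3]
  have e5 : ∀ m ≤ r, ∏ j ∈ Finset.range m, (-1 : ℤ) ^ flipInv a ((r * (N / r) + j) % r) =
      ∏ j ∈ Finset.range m, (-1 : ℤ) ^ flipInv a j := fun m hm =>
    Finset.prod_congr rfl fun j hj => by
      rw [Nat.mul_add_mod, Nat.mod_eq_of_lt ((Finset.mem_range.1 hj).trans_le hm)]
  rw [e5 _ (Nat.mod_lt N hr).le]
  by_cases h0 : N % r = 0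
  · have : (N + r - 1) / r = N / r := by
      conv_lhs => rw [← hNd, h0, add_zero, Nat.add_sub_assoc hr, Nat.mul_add_div hr,
        Nat.div_eq_of_lt (by omega : r - 1 < r), add_zero]
    rw [h0, this, Finset.prod_range_zero, mul_one, mul_pow, ← pow_mul, ← pow_mul, pow_add,
      mul_comm (N / r), mul_comm (N / r)]
  · have h1 : N % r = a := hN.resolve_left h0
    have : (N + r - 1) / r = N / r + 1 := by
      rw [Nat.div_eq_iff hr]
      rw [add_mul, mul_comm _ r]
      have := Nat.mod_lt N hr
      omega
    rw [h1, e1, this, mul_pow, ← pow_mul, ← pow_mul, pow_add, add_mul, pow_add,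
      mul_comm (N / r), mul_comm (N / r)]
    ring

end ClassSign

section ClassDeterminant

variable {q : ℝ} {r a N : ℕ} {u v : ℂ}

/-- The product `∏ (1 - q^{m+z})` over the integers `m > P` congruent to `a` modulo `r`. -/
noncomputable def tailProd (q : ℝ) (r a : ℕ) (z : ℂ) (P : ℕ) : ℂ :=
  qPochInf (q ^ r) ((q : ℂ) ^ ((nextCongr r a P : ℂ) + z))

/-- The constant in front of every nonvanishing moment. -/
noncomputable def momentConst (q : ℝ) (r : ℕ) (v : ℂ) : ℂ :=
  r * ((1 - (q : ℂ)) / (2 * (Real.pi : ℂ)) *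
    (qPochInf (q ^ r) ((q ^ r : ℝ) : ℂ) / qPochInf (q ^ r) ((q ^ r : ℝ) ^ (v + 1))))

lemma ofReal_pos_ne_zero (hq0 : 0 < q) : (q : ℂ) ≠ 0 := by exact_mod_cast hq0.ne'

lemma pow_r_mul_eq (k : ℕ) :
    ((q ^ r : ℝ) : ℂ) ^ k = (q : ℂ) ^ (((r * k : ℕ) : ℂ)) := by
  rw [Complex.cpow_natCast, pow_mul]; push_cast; rfl

lemma tailProd_eq (hq0 : 0 < q) (z : ℂ) (P : ℕ) :
    tailProd q r a z P = qPochInf (q ^ r)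
      ((q : ℂ) ^ ((nextCongr r a (P % r) : ℂ) + z) * ((q ^ r : ℝ) : ℂ) ^ (P / r)) := by
  rw [tailProd, pow_r_mul_eq, ← Complex.cpow_add _ _ (ofReal_pos_ne_zero hq0),
    nextCongr_eq_add r a P]
  push_cast
  ring_nf

lemma tailProd_ne_zero (hq0 : 0 < q) (hq1 : q < 1) (hr : 0 < r) (hu : -1 < (r : ℝ) * u.re)
    (P : ℕ) : tailProd q r a (r * u) P ≠ 0 := by
  have hQ0 := pow_pos hq0 r
  have hQ1 := pow_lt_one₀ hq0.le hq1 hr.ne'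
  refine qPochInf_ne_zero hQ0 hQ1 (pow_mul_ne_one hQ0 hQ1 ?_)
  rw [Complex.norm_cpow_eq_rpow_re_of_pos hq0]
  apply Real.rpow_lt_one hq0.le hq1
  simp only [nextCongr]
  have h1 := P.cast_nonneg (α := ℝ)
  have h2 := (gapTo r a P).cast_nonneg (α := ℝ)
  simp
  linarith

lemma add_classFlip_add_one {P j : ℕ} (h : P % r = j % r) :
    P + classFlip r a j + 1 = nextCongr r a P + r * (j / r) := by
  rw [classFlip, nextCongr, gapTo_congr h]
  ring

lemma add_classFlip_modEq_iff (ha : a < r) (P j : ℕ) :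
    P + classFlip r a j + 1 ≡ a [MOD r] ↔ P % r = j % r := by
  have hr : 0 < r := by omega
  constructor
  · intro h
    have h1 : j + classFlip r a j + 1 ≡ a [MOD r] := by
      rw [add_classFlip_add_one rfl, Nat.ModEq, Nat.add_mul_mod_self_left, nextCongr_modEq ha,
        Nat.mod_eq_of_lt ha]
    have h2 := h.trans h1.symm
    rw [add_assoc, add_assoc] at h2
    exact Nat.ModEq.add_right_cancel' _ h2
  · intro h
    rw [add_classFlip_add_one h, Nat.ModEq, Nat.add_mul_mod_self_left, nextCongr_modEq ha,
      Nat.mod_eq_of_lt ha]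

lemma moment_classFlip (hq0 : 0 < q) (ha : a < r) {P j : ℕ} (h : P % r = j % r) :
    moment q r a u v (P + classFlip r a j) = momentConst q r v *
      (qPochInf (q ^ r) (((q ^ r : ℝ) : ℂ) ^ (v + 1) *
          (q : ℂ) ^ ((nextCongr r a (j % r) : ℂ) + r * u) * ((q ^ r : ℝ) : ℂ) ^ (P / r + j / r)) /
        qPochInf (q ^ r)
          ((q : ℂ) ^ ((nextCongr r a (j % r) : ℂ) + r * u) *
            ((q ^ r : ℝ) : ℂ) ^ (P / r + j / r))) := by
  have e : (q : ℂ) ^ (((P + classFlip r a j : ℕ) : ℂ) + 1 + r * u) =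
      (q : ℂ) ^ ((nextCongr r a (j % r) : ℂ) + r * u) * ((q ^ r : ℝ) : ℂ) ^ (P / r + j / r) := by
    rw [pow_r_mul_eq, ← Complex.cpow_add _ _ (ofReal_pos_ne_zero hq0)]
    have h1 : (((P + classFlip r a j : ℕ) : ℂ) + 1) =
        ((nextCongr r a (j % r) + r * (P / r) + r * (j / r) : ℕ) : ℂ) := by
      rw [← h, ← nextCongr_eq_add, ← add_classFlip_add_one h]
      push_cast; ring
    rw [h1]
    push_cast
    ring_nf
  rw [moment, if_pos ((add_classFlip_modEq_iff ha P j).2 h), rayMoment, e, momentConst, mul_assoc (_ ^ _)]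
  ring

/-- The factor of the row `j` in the determinant of moments with exponents `R`. -/
noncomputable def rowFactor (q : ℝ) (r a : ℕ) (u v : ℂ) (N : ℕ) (R : ℕ → ℕ) (j : ℕ) : ℂ :=
  momentConst q r v *
    (tailProd q r a (r * u + r * v) (R j + N) / tailProd q r a (r * u) (R j)) *
    ∏ t ∈ Finset.range (j / r),
      ((1 - ((q ^ r : ℝ) : ℂ) ^ (v + 1) * ((q ^ r : ℝ) : ℂ) ^ t) *
        ((q : ℂ) ^ ((nextCongr r a (j % r) : ℂ) + r * u) * ((q ^ r : ℝ) : ℂ) ^ t) *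
        (((q ^ r : ℝ) : ℂ) ^ (R (r * t + j % r) / r) - ((q ^ r : ℝ) : ℂ) ^ (R j / r)))

/-- The determinant of moments whose exponents run through the residue classes as `0, 1, …` do. -/
lemma det_moment_classFlip (hq0 : 0 < q) (hq1 : q < 1) (ha : a < r)
    (hN : N % r = 0 ∨ N % r = a) (hu : -1 < (r : ℝ) * u.re) (R : ℕ → ℕ)
    (hR : ∀ j < N, R j % r = j % r) :
    (Matrix.of fun i j : Fin N => moment q r a u v (R i + classFlip r a j)).det =
      ∏ j ∈ Finset.range N, rowFactor q r a u v N R j := by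
  have hr : 0 < r := by omega
  have hq := ofReal_pos_ne_zero hq0
  set M := Matrix.of fun i j : Fin N => moment q r a u v (R i + classFlip r a j) with hM
  set b : Fin N → Fin r := fun i => ⟨i % r, Nat.mod_lt _ hr⟩ with hb
  have hT : M.BlockTriangular b := by
    intro i j hij
    rw [hM, Matrix.of_apply, moment, if_neg]
    rw [add_classFlip_modEq_iff ha, hR i i.2]
    intro h
    exact hij.ne' (Fin.ext h)
  rw [hT.det_fintype, prod_range_eq_prod_classes hr]
  refine Finset.prod_congr rfl fun ν _ => ?_
  set n := classCard r N ν with hn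
  set A := (q : ℂ) ^ ((nextCongr r a ν : ℂ) + r * u) with hA
  have hd : ∀ y, (r * y + ν) / r = y := fun y => by
    rw [Nat.mul_add_div hr, Nat.div_eq_of_lt ν.2, add_zero]
  have hm : ∀ y, (r * y + ν) % r = ν := fun y => by
    rw [Nat.mul_add_mod, Nat.mod_eq_of_lt ν.2]
  have hlt : ∀ y : Fin n, r * y + ν < N := fun y => (lt_classCard_iff hr ν.2 y).1 y.2
  have hRm : ∀ y : Fin n, R (r * y + ν) % r = ν := fun y => by rw [hR _ (hlt y), hm]
  have e1 : (M.toSquareBlock b ν).submatrix (classEquiv hr N ν) (classEquiv hr N ν) =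
      momentConst q r v • Matrix.of fun i y : Fin n =>
        qPochInf (q ^ r) (((q ^ r : ℝ) : ℂ) ^ (v + 1) * A *
          ((q ^ r : ℝ) : ℂ) ^ (R (r * i + ν) / r + y)) /
        qPochInf (q ^ r) (A * ((q ^ r : ℝ) : ℂ) ^ (R (r * i + ν) / r + y)) := by
    ext i y
    simp only [Matrix.submatrix_apply, Matrix.toSquareBlock_def, Matrix.of_apply,
      Matrix.smul_apply, smul_eq_mul, hM]
    have h := moment_classFlip (u := u) (v := v) hq0 ha
      (P := R (r * i + ν)) (j := r * y + ν) (by rw [hRm, hm])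
    rw [hd, hm] at h
    exact h
  rw [← Matrix.det_submatrix_equiv_self (classEquiv hr N ν), e1, Matrix.det_smul, Fintype.card_fin,
    det_qPochInf_ratio (pow_pos hq0 r) (pow_lt_one₀ hq0.le hq1 hr.ne')
      (x := fun i : Fin n => R (r * i + ν) / r)]
  rotate_left
  · exact Complex.cpow_ne_zero_iff.2 (Or.inl hq)
  · intro i
    have := tailProd_ne_zero (a := a) hq0 hq1 hr hu (R (r * i + ν))
    rwa [tailProd_eq hq0, hRm] at this
  have e2 : ∀ i : Fin n,
      qPochInf (q ^ r) (((q ^ r : ℝ) : ℂ) ^ (v + 1) * A *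
        ((q ^ r : ℝ) : ℂ) ^ (R (r * i + ν) / r + (n - 1))) /
        qPochInf (q ^ r) (A * ((q ^ r : ℝ) : ℂ) ^ (R (r * i + ν) / r)) =
      tailProd q r a (r * u + r * v) (R (r * i + ν) + N) /
        tailProd q r a (r * u) (R (r * i + ν)) := fun i => by
    rw [tailProd_eq hq0 (r * u) (R _), hRm, tailProd, ← mul_classCard ha hN, hRm, ← hn, hA]
    congr 2
    rw [pow_r_mul_eq, ofReal_pow_cpow hq0, ← Complex.cpow_add _ _ hq,
      ← Complex.cpow_add _ _ hq, nextCongr_eq_add r a (R _), hRm]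
    congr 1
    have hn1 : ((n - 1 : ℕ) : ℂ) = n - 1 := by
      rw [Nat.cast_sub (by have := i.2; omega), Nat.cast_one]
    push_cast
    rw [hn1]
    ring
  have hAne : A ≠ 0 := Complex.cpow_ne_zero_iff.2 (Or.inl hq)
  simp only [e2, mul_div_cancel_right₀ _ hAne]
  rw [← Fin.prod_univ_eq_prod_range, ← Fin.prod_univ_eq_prod_range, ← Finset.prod_mul_distrib,
    ← Finset.prod_mul_distrib]
  have e3 : momentConst q r v ^ n = ∏ _i : Fin n, momentConst q r v := by simp
  rw [e3, ← Finset.prod_mul_distrib]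
  refine Finset.prod_congr rfl fun y _ => ?_
  rw [rowFactor, hd, hm, ← hA, prod_Iio_eq_prod_range y fun i =>
    ((q ^ r : ℝ) : ℂ) ^ (R (r * i + ν) / r) - ((q ^ r : ℝ) : ℂ) ^ (R (r * y + ν) / r),
    Finset.prod_mul_distrib (f := fun t => (1 - ((q ^ r : ℝ) : ℂ) ^ (v + 1) *
      ((q ^ r : ℝ) : ℂ) ^ t) * (A * ((q ^ r : ℝ) : ℂ) ^ t))]
  ring

end ClassDeterminant

section MomentDeterminant

variable {q : ℝ} {r a N : ℕ} {u v : ℂ}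

lemma momentDet_eq_sign_mul (hq0 : 0 < q) (hq1 : q < 1) (ha : a < r)
    (hN : N % r = 0 ∨ N % r = a) (hu : -1 < (r : ℝ) * u.re) (l : YoungDiagram)
    (e : Equiv.Perm (Fin N)) (R : ℕ → ℕ) (hR : ∀ j < N, R j % r = j % r)
    (he : ∀ i : Fin N, R (Fin.rev (e i)) = betaSet N l i) :
    momentDet q r a u v N l = (Equiv.Perm.sign e : ℤ) * deltaN r a N *
      ∏ j ∈ Finset.range N, rowFactor q r a u v N R j := by
  rw [← det_moment_classFlip hq0 hq1 ha hN hu R hR, ← sign_flipPerm ha hN]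
  set M := Matrix.of fun i j : Fin N =>
    moment q r a u v (betaSet N l i + (N - ((j : ℕ) + 1))) with hM
  set ρ : Equiv.Perm (Fin N) := Fin.revPerm
  have h1 : (Matrix.of fun i j : Fin N => moment q r a u v (R i + classFlip r a j)) =
      ((M.submatrix (ρ.trans e.symm) id).submatrix id ((flipPerm ha hN).trans ρ)) := by
    ext i j
    simp only [hM, Matrix.submatrix_apply, Matrix.of_apply, id, Equiv.trans_apply]
    congr 2
    · rw [← he]; simp [ρ]
    · have := (flipPerm ha hN j).2
      simp only [ρ, Fin.revPerm_apply, Fin.val_rev]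
      have h2 : ((flipPerm ha hN j : Fin N) : ℕ) = classFlip r a j := rfl
      omega
  have hs : ∀ π : Equiv.Perm (Fin N),
      ((Equiv.Perm.sign π : ℤ) : ℂ) * ((Equiv.Perm.sign π : ℤ) : ℂ) = 1 := fun π => by
    rw [← Int.cast_mul, ← Units.val_mul, Int.units_mul_self]; simp
  rw [h1, Matrix.det_permute', Matrix.det_permute, momentDet, ← hM, Equiv.Perm.sign_trans,
    Equiv.Perm.sign_trans, Equiv.Perm.sign_symm]
  simp only [Units.val_mul, Int.cast_mul]
  have a1 := hs e
  have a2 := hs ρ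
  have a3 := hs (flipPerm ha hN)
  generalize ((Equiv.Perm.sign e : ℤ) : ℂ) = x at *
  generalize ((Equiv.Perm.sign ρ : ℤ) : ℂ) = y at *
  generalize ((Equiv.Perm.sign (flipPerm ha hN) : ℤ) : ℂ) = z at *
  linear_combination (-(M.det * y * y * z * z)) * a1 - M.det * z * z * a2 - M.det * a3

lemma exists_perm_of_momentDet_ne_zero {l : YoungDiagram}
    (h : momentDet q r a u v N l ≠ 0) :
    ∃ π : Equiv.Perm (Fin N), ∀ i : Fin N,
      betaSet N l i + (N - ((π i : ℕ) + 1)) + 1 ≡ a [MOD r] := by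
  by_contra hc
  push Not at hc
  apply h
  rw [momentDet, ← Matrix.det_transpose, Matrix.det_apply]
  refine Finset.sum_eq_zero fun π _ => ?_
  obtain ⟨i, hi⟩ := hc π
  rw [Finset.prod_eq_zero (Finset.mem_univ i), smul_zero]
  rw [Matrix.transpose_apply, Matrix.of_apply, moment, if_neg hi]

end MomentDeterminant

section Vanishing

variable {q : ℝ} {r a N : ℕ} {u v : ℂ}

lemma add_add_one_modEq_iff (ha : a < r) (P s : ℕ) :
    P + s + 1 ≡ a [MOD r] ↔ s % r = gapTo r a P := by
  have hr : 0 < r := by omega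
  have h1 : P + gapTo r a P + 1 ≡ a [MOD r] := by
    have := nextCongr_modEq ha P
    rw [nextCongr] at this
    rw [Nat.ModEq, Nat.mod_eq_of_lt ha, add_right_comm, this]
  constructor
  · intro h
    have h2 := h.trans h1.symm
    have h3 : s ≡ gapTo r a P [MOD r] :=
      Nat.ModEq.add_left_cancel' P (Nat.ModEq.add_right_cancel' 1 h2)
    rw [Nat.ModEq, Nat.mod_eq_of_lt (gapTo_lt hr P)] at h3
    exact h3
  · intro h
    have h3 : s ≡ gapTo r a P [MOD r] := by
      rw [Nat.ModEq, Nat.mod_eq_of_lt (gapTo_lt hr P), h]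
    exact ((h3.add_left P).add_right 1).trans h1

lemma card_filter_mod_eq (hr : 0 < r) {ν : ℕ} (hν : ν < r) :
    ((Finset.range N).filter fun s => s % r = ν).card = classCard r N ν := by
  rw [← Finset.card_range (classCard r N ν)]
  refine Finset.card_nbij' (fun s => s / r) (fun y => r * y + ν) ?_ ?_ ?_ ?_
  · intro s hs
    simp only [Finset.coe_filter, Finset.mem_range, Set.mem_ofPred_eq, Finset.coe_range,
      Set.mem_Iio] at hs ⊢
    rw [lt_classCard_iff hr hν, ← hs.2, Nat.div_add_mod]
    exact hs.1
  · intro y hy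
    simp only [Finset.coe_filter, Finset.mem_range, Set.mem_ofPred_eq, Finset.coe_range,
      Set.mem_Iio] at hy ⊢
    exact ⟨(lt_classCard_iff hr hν y).1 hy, by rw [Nat.mul_add_mod, Nat.mod_eq_of_lt hν]⟩
  · intro s hs
    simp only [Finset.coe_filter, Finset.mem_range, Set.mem_ofPred_eq] at hs
    have := Nat.div_add_mod s r
    simp only
    omega
  · intro y _
    simp only
    rw [Nat.mul_add_div hr, Nat.div_eq_of_lt hν, add_zero]

lemma card_betaSet_of_momentDet_ne_zero (ha : a < r) {l : YoungDiagram}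
    (h : momentDet q r a u v N l ≠ 0) {ν : ℕ} (hν : ν < r) :
    ((Finset.range N).filter fun i => betaSet N l i % r = ν).card =
      classCard r N (gapTo r a ν) := by
  have hr : 0 < r := by omega
  obtain ⟨π, hπ⟩ := exists_perm_of_momentDet_ne_zero h
  have hπ' : ∀ i : Fin N, (N - ((π i : ℕ) + 1)) % r = gapTo r a (betaSet N l i) := fun i =>
    (add_add_one_modEq_iff ha _ _).1 (hπ i)
  have hinj : ∀ P P' : ℕ, gapTo r a P = gapTo r a P' ↔ P % r = P' % r := fun P P' => by
    have h1 := Nat.mod_lt P hr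
    have h2 := Nat.mod_lt P' hr
    rw [gapTo_eq ha, gapTo_eq ha]
    split_ifs <;> omega
  rw [← card_filter_mod_eq hr (gapTo_lt hr ν), Finset.card_filter, Finset.card_filter,
    ← Fin.sum_univ_eq_sum_range (fun i => if betaSet N l i % r = ν then 1 else 0),
    ← Fin.sum_univ_eq_sum_range (fun s => if s % r = gapTo r a ν then 1 else 0),
    ← Equiv.sum_comp (π.trans Fin.revPerm)
      (fun s : Fin N => if (s : ℕ) % r = gapTo r a ν then 1 else 0)]
  refine Finset.sum_congr rfl fun i _ => ?_
  have h1 : ((π.trans Fin.revPerm i : Fin N) : ℕ) = N - ((π i : ℕ) + 1) := by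
    simp [Fin.val_rev]
  simp only [h1, hπ', hinj, Nat.mod_eq_of_lt hν]

lemma betaSet_bot (N i : ℕ) : betaSet N ⊥ i = N - (i + 1) := by
  rw [betaSet, rowLen_bot, add_zero]

lemma card_betaSet_bot (hr : 0 < r) {ν : ℕ} (hν : ν < r) :
    ((Finset.range N).filter fun i => betaSet N ⊥ i % r = ν).card = classCard r N ν := by
  rw [← card_filter_mod_eq hr hν, Finset.card_filter, Finset.card_filter,
    ← Finset.sum_range_reflect (fun s => if s % r = ν then 1 else 0)]
  refine Finset.sum_congr rfl fun i hi => ?_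
  rw [betaSet_bot, Nat.sub_sub, add_comm 1 i]

lemma momentDet_bot_eq_zero (ha : a < r) (hN : ¬ (N % r = 0 ∨ N % r = a)) :
    momentDet q r a u v N ⊥ = 0 := by
  by_contra h
  have hr : 0 < r := by omega
  have key : ∀ ν < r, classCard r N ν = classCard r N (gapTo r a ν) := fun ν hν => by
    rw [← card_betaSet_of_momentDet_ne_zero ha h hν, card_betaSet_bot hr hν]
  push Not at hN
  have hm := Nat.mod_lt N hr
  rcases lt_or_ge (N % r) a with h1 | h1
  · have := key 0 hr
    rw [classCard_eq hr hr, classCard_eq hr (gapTo_lt hr 0), gapTo_eq ha, Nat.zero_mod] at this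
    split_ifs at this <;> omega
  · have := key a ha
    rw [classCard_eq hr ha, classCard_eq hr (gapTo_lt hr a), gapTo_eq ha,
      Nat.mod_eq_of_lt ha] at this
    split_ifs at this <;> omega

end Vanishing

section Exponents

variable {r a N : ℕ}

lemma prod_cpow {ι : Type*} {x : ℂ} (hx : x ≠ 0) (s : Finset ι) (f : ι → ℂ) :
    ∏ i ∈ s, x ^ f i = x ^ ∑ i ∈ s, f i := by
  classical
  induction s using Finset.induction_on with
  | empty => simp
  | insert i s hi ih => rw [Finset.prod_insert hi, Finset.sum_insert hi, ih, Complex.cpow_add _ _ hx]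

lemma sum_range_choose_const (k n : ℕ) :
    ∑ y ∈ Finset.range n, (y.choose k : ℂ) = (n.choose (k + 1) : ℂ) := by
  induction n with
  | zero => simp
  | succ n ih => rw [Finset.sum_range_succ, ih, Nat.choose_succ_succ' n k]; push_cast; ring

lemma sum_range_cast (n : ℕ) : ∑ y ∈ Finset.range n, (y : ℂ) = (n.choose 2 : ℂ) := by
  rw [← sum_range_choose_const 1]
  simp

/-- The exponents of `1 - q^r` sum up to `N`. -/
lemma sum_classCard_sub (hr : 0 < r) (N : ℕ) :
    ∑ I ∈ Finset.range N, ((classCard r N (I % r) : ℂ) - 2 * ((I / r : ℕ) : ℂ)) = N := by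
  have h1 : (N : ℂ) = ∑ I ∈ Finset.range N, 1 := by simp
  conv_rhs => rw [h1]
  rw [sum_range_eq_sum_classes hr, sum_range_eq_sum_classes hr]
  refine Finset.sum_congr rfl fun ν _ => ?_
  have e : ∀ y ∈ Finset.range (classCard r N ν),
      ((classCard r N ((r * y + ν) % r) : ℂ) - 2 * (((r * y + ν) / r : ℕ) : ℂ)) =
      (classCard r N ν : ℂ) - 2 * (y : ℂ) := fun y _ => by
    rw [Nat.mul_add_mod, Nat.mod_eq_of_lt ν.2, Nat.mul_add_div hr, Nat.div_eq_of_lt ν.2, add_zero]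
  rw [Finset.sum_congr rfl e, Finset.sum_sub_distrib, ← Finset.mul_sum, sum_range_cast,
    Nat.cast_choose_two]
  simp
  ring

lemma floor_sub_eq (ha : a < r) (I : ℕ) :
    (r : ℤ) * (((I : ℤ) - a) / (r : ℤ)) = (nextCongr r a I : ℤ) - a - r := by
  have hr : 0 < r := by omega
  have h1 := Nat.div_add_mod (nextCongr r a I) r
  rw [nextCongr_modEq ha] at h1
  have h2 := gapTo_lt (a := a) hr I
  have h3 : ((I : ℤ) - a) / (r : ℤ) = (nextCongr r a I / r : ℕ) - 1 := by
    rw [Int.ediv_eq_iff_of_pos (by exact_mod_cast hr)]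
    have h4 : (r : ℤ) * ((nextCongr r a I / r : ℕ) : ℤ) + a = nextCongr r a I := by exact_mod_cast h1
    have h5 : (nextCongr r a I : ℤ) = I + 1 + gapTo r a I := by rw [nextCongr]; push_cast; rfl
    have h6 : ((nextCongr r a I / r : ℕ) : ℤ) * (r : ℤ) + a = nextCongr r a I := by
      rw [mul_comm]; exact h4
    constructor
    · rw [sub_mul, one_mul]; omega
    · rw [sub_mul, one_mul]; omega
  rw [h3]
  have h4 : (r : ℤ) * ((nextCongr r a I / r : ℕ) : ℤ) + a = nextCongr r a I := by exact_mod_cast h1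
  linarith

lemma mul_fl (ha : a < r) (I : ℕ) :
    (r : ℂ) * fl r I a = (nextCongr r a I : ℂ) - a - r := by
  rw [fl]
  exact_mod_cast congrArg (Int.cast : ℤ → ℂ) (floor_sub_eq ha I)

lemma fl_zero (I : ℕ) : fl r I 0 = ((I / r : ℕ) : ℂ) := by
  rw [fl, Nat.cast_zero, sub_zero, ← Int.natCast_div, Int.cast_natCast]

lemma sub_gapTo_eq {ν : ℕ} (hν : ν < r) :
    (N : ℤ) - gapTo r N ν - 1 = r * ((classCard r N ν : ℤ) - 1) + ν := by
  have h := Nat.div_add_mod (N + (r - 1 - ν)) r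
  have h1 : gapTo r N ν = (N + (r - 1 - ν)) % r := by rw [gapTo, Nat.mod_eq_of_lt hν]
  rw [← h1] at h
  have h2 : (r : ℤ) * classCard r N ν + gapTo r N ν = N + (r - 1 - ν) := by
    rw [classCard]; omega
  linarith

lemma nMu_gapTo (hr : 0 < r) {ν : ℕ} (hν : ν < r) :
    nMu r N (gapTo r N ν) = classCard r N ν := by
  rw [nMu, sub_gapTo_eq hν, Int.mul_add_ediv_left _ _ (by exact_mod_cast hr.ne'),
    Int.ediv_eq_zero_of_lt (by omega) (by exact_mod_cast hν)]
  simp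

lemma uMu_gapTo (ha : a < r) (u : ℂ) {ν : ℕ} (hν : ν < r) :
    (r : ℂ) * (uMu r a u N (gapTo r N ν) + 1) = (nextCongr r a ν : ℂ) + r * u := by
  have hr : 0 < r := by omega
  have hrZ : (r : ℤ) ≠ 0 := by exact_mod_cast hr.ne'
  have hrC : (r : ℂ) ≠ 0 := by exact_mod_cast hr.ne'
  have h1 : (N : ℤ) - gapTo r N ν - a - 1 = r * ((classCard r N ν : ℤ) - 1) + (ν - a) := by
    have := sub_gapTo_eq (N := N) hν
    linarith
  rw [uMu, h1, sub_gapTo_eq hν, Int.mul_add_ediv_left _ _ hrZ, Int.mul_add_ediv_left _ _ hrZ,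
    Int.ediv_eq_zero_of_lt (by omega : (0 : ℤ) ≤ ν) (by exact_mod_cast hν)]
  have h2 := mul_fl ha ν
  rw [fl] at h2
  push_cast at h2 ⊢
  field_simp
  linear_combination h2

lemma gapTo_gapTo (ha : a < r) {ν : ℕ} (hν : ν < r) : gapTo r a (gapTo r a ν) = ν := by
  have hr : 0 < r := by omega
  rw [gapTo_eq ha, Nat.mod_eq_of_lt (gapTo_lt hr ν), gapTo_eq ha, Nat.mod_eq_of_lt hν]
  split_ifs <;> omega

lemma gapTo_mod (r a P : ℕ) : gapTo r (a % r) P = gapTo r a P := by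
  simp [gapTo]

lemma nrN_eq (ha : a < r) (u : ℂ) (N : ℕ) :
    (r : ℂ) * nrN r a u N = ∑ j ∈ Finset.range N,
      (((j / r : ℕ) : ℂ) * ((nextCongr r a (j % r) : ℂ) + r * u) +
        2 * r * ((j / r).choose 2 : ℂ)) := by
  have hr : 0 < r := by omega
  have hinv : ∀ ν < r, gapTo r N (gapTo r N ν) = ν := fun ν hν => by
    rw [← gapTo_mod r N, ← gapTo_mod r N, gapTo_gapTo (Nat.mod_lt N hr) hν]
  rw [sum_range_eq_sum_classes hr, nrN, Finset.mul_sum]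
  rw [Fin.sum_univ_eq_sum_range fun ν => ∑ y ∈ Finset.range (classCard r N ν),
    ((((r * y + ν) / r : ℕ) : ℂ) * ((nextCongr r a ((r * y + ν) % r) : ℂ) + r * u) +
        2 * r * (((r * y + ν) / r).choose 2 : ℂ))]
  refine Finset.sum_nbij' (gapTo r N) (gapTo r N)
    (fun ν _ => Finset.mem_range.2 (gapTo_lt hr ν)) (fun ν _ => Finset.mem_range.2 (gapTo_lt hr ν))
    (fun ν hν => hinv ν (Finset.mem_range.1 hν)) (fun ν hν => hinv ν (Finset.mem_range.1 hν)) ?_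
  intro μ hμ
  set ν := gapTo r N μ with hνdef
  have hν : ν < r := gapTo_lt hr μ
  have hμν : μ = gapTo r N ν := (hinv μ (Finset.mem_range.1 hμ)).symm
  have e : ∀ y ∈ Finset.range (classCard r N ν),
      ((((r * y + ν) / r : ℕ) : ℂ) * ((nextCongr r a ((r * y + ν) % r) : ℂ) + r * u) +
        2 * r * (((r * y + ν) / r).choose 2 : ℂ)) =
      (y : ℂ) * ((nextCongr r a ν : ℂ) + r * u) + 2 * r * (y.choose 2 : ℂ) := fun y _ => by
    rw [Nat.mul_add_mod, Nat.mod_eq_of_lt hν, Nat.mul_add_div hr, Nat.div_eq_of_lt hν, add_zero]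
  rw [Finset.sum_congr rfl e, Finset.sum_add_distrib, ← Finset.sum_mul, ← Finset.mul_sum,
    sum_range_cast, sum_range_choose_const, hμν, nMu_gapTo hr hν, ← uMu_gapTo (N := N) ha u hν]
  ring

end Exponents

section PartitionFunction

variable {q : ℝ} {r a N : ℕ} {u v : ℂ}

lemma one_sub_ne_zero (hq1 : q < 1) : (1 : ℂ) - (q : ℂ) ≠ 0 := by
  rw [sub_ne_zero]; exact_mod_cast hq1.ne'

lemma qGamma_eq (hq0 : 0 < q) (x : ℂ) :
    qGamma q x = (1 - (q : ℂ)) ^ (1 - x) * (qPochInf q q / qPochInf q ((q : ℂ) ^ x)) := by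
  rw [qGamma, qPoch, Complex.cpow_sub _ _ (ofReal_pos_ne_zero hq0), Complex.cpow_one,
    mul_div_cancel₀ _ (ofReal_pos_ne_zero hq0)]

lemma qPochInf_self_ne_zero (hq0 : 0 < q) (hq1 : q < 1) : qPochInf q (q : ℂ) ≠ 0 :=
  qPochInf_ne_zero hq0 hq1 (pow_mul_ne_one hq0 hq1 (norm_ofReal_lt_one hq0 hq1))

lemma qGamma_fl (hq0 : 0 < q) (ha : a < r) (I : ℕ) (z : ℂ) :
    qGamma (q ^ r) (fl r I a + (a : ℂ) / r + z + 1) =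
      (1 - ((q ^ r : ℝ) : ℂ)) ^ (-((nextCongr r a I : ℂ) / r + z - 1)) *
        (qPochInf (q ^ r) ((q ^ r : ℝ) : ℂ) / tailProd q r a (r * z) I) := by
  have hrC : (r : ℂ) ≠ 0 := by
    have : r ≠ 0 := by omega
    exact_mod_cast this
  have h : fl r I a + (a : ℂ) / r + z + 1 = (nextCongr r a I : ℂ) / r + z := by
    have := mul_fl ha I
    field_simp
    linear_combination this
  rw [h, qGamma_eq (pow_pos hq0 r), ofReal_pow_cpow hq0, tailProd]
  congr 2
  · ring
  · congr 2
    field_simp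

lemma qGamma_natCast_add (hq0 : 0 < q) (hq1 : q < 1) (y : ℕ) (z : ℂ)
    (hz : ∀ i : ℕ, (q : ℂ) ^ i * (q : ℂ) ^ (z + 1) ≠ 1) :
    qGamma q (y + z + 1) = (1 - (q : ℂ)) ^ (-(y + z)) *
      (qPochInf q q / qPochInf q ((q : ℂ) ^ (z + 1)) *
        ∏ t ∈ Finset.range y, (1 - (q : ℂ) ^ (z + 1) * (q : ℂ) ^ t)) := by
  have hq := ofReal_pos_ne_zero hq0
  have h1 : (q : ℂ) ^ ((y : ℂ) + z + 1) = (q : ℂ) ^ y * (q : ℂ) ^ (z + 1) := by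
    rw [add_assoc, Complex.cpow_add _ _ hq, Complex.cpow_natCast]
  have h2 := qPochInf_ne_zero hq0 hq1 hz
  have h3 := qPochInf_eq_prod_mul hq0 hq1 ((q : ℂ) ^ (z + 1)) y
  have h4 : ∏ t ∈ Finset.range y, (1 - (q : ℂ) ^ t * (q : ℂ) ^ (z + 1)) =
      ∏ t ∈ Finset.range y, (1 - (q : ℂ) ^ (z + 1) * (q : ℂ) ^ t) :=
    Finset.prod_congr rfl fun t _ => by rw [mul_comm]
  rw [h4] at h3
  rw [h3] at h2
  have h5 := left_ne_zero_of_mul h2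
  have h6 := right_ne_zero_of_mul h2
  rw [qGamma_eq hq0, h1, h3]
  generalize ∏ t ∈ Finset.range y, (1 - (q : ℂ) ^ (z + 1) * (q : ℂ) ^ t) = P at *
  have h7 : (1 : ℂ) - (y + z + 1) = -(y + z) := by ring
  rw [h7]
  field_simp

lemma pow_mul_cpow_ne_one (hq0 : 0 < q)
    (hv : ∀ n : ℕ, (q : ℂ) ^ ((r : ℂ) * (v + n + 1)) ≠ 1) (i : ℕ) :
    ((q ^ r : ℝ) : ℂ) ^ i * ((q ^ r : ℝ) : ℂ) ^ (v + 1) ≠ 1 := by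
  rw [← Complex.cpow_natCast, ← Complex.cpow_add _ _ (ofReal_pos_ne_zero (pow_pos hq0 r)),
    ofReal_pow_cpow hq0]
  convert hv i using 3
  ring

lemma rowFactor_id (hq0 : 0 < q) (hr : 0 < r) (j : ℕ) :
    rowFactor q r a u v N id j =
      momentConst q r v * (tailProd q r a (r * u + r * v) (j + N) / tailProd q r a (r * u) j) *
      (((q ^ r : ℝ) : ℂ) ^ ((((j / r : ℕ) : ℂ) * ((nextCongr r a (j % r) : ℂ) + r * u) +
        2 * r * ((j / r).choose 2 : ℂ)) / r) *
      ((∏ t ∈ Finset.range (j / r), (1 - ((q ^ r : ℝ) : ℂ) ^ (v + 1) * ((q ^ r : ℝ) : ℂ) ^ t)) *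
        ∏ t ∈ Finset.range (j / r), (1 - ((q ^ r : ℝ) : ℂ) * ((q ^ r : ℝ) : ℂ) ^ t))) := by
  have hq := ofReal_pos_ne_zero hq0
  have hQ := ofReal_pos_ne_zero (pow_pos hq0 r)
  have hrC : (r : ℂ) ≠ 0 := by exact_mod_cast hr.ne'
  set Q := ((q ^ r : ℝ) : ℂ) with hQdef
  set A := (q : ℂ) ^ ((nextCongr r a (j % r) : ℂ) + r * u) with hA
  set y := j / r with hy
  have e1 : ∏ t ∈ Finset.range y, (1 - Q * Q ^ t) = ∏ t ∈ Finset.range y, (1 - Q ^ (y - t)) := by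
    rw [← Finset.prod_range_reflect]
    refine Finset.prod_congr rfl fun t ht => ?_
    rw [← pow_succ']
    congr 2
    have := Finset.mem_range.1 ht
    omega
  have e2 : Q ^ (((y : ℂ) * ((nextCongr r a (j % r) : ℂ) + r * u) +
        2 * r * (y.choose 2 : ℂ)) / r) = ∏ t ∈ Finset.range y, (A * Q ^ t * Q ^ t) := by
    have h1 : ∀ t ∈ Finset.range y, A * Q ^ t * Q ^ t =
        Q ^ (((nextCongr r a (j % r) : ℂ) + r * u) / r + 2 * (t : ℂ)) := fun t _ => by
      rw [Complex.cpow_add _ _ hQ, two_mul, Complex.cpow_add _ _ hQ, Complex.cpow_natCast, hQdef,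
        ofReal_pow_cpow hq0 r (_ / _), mul_div_cancel₀ _ hrC, hA]
      ring
    rw [Finset.prod_congr rfl h1, prod_cpow hQ, Finset.sum_add_distrib, ← Finset.mul_sum,
      sum_range_cast]
    congr 1
    simp
    field_simp
  rw [rowFactor, e1, e2, ← Finset.prod_mul_distrib, ← Finset.prod_mul_distrib]
  simp only [id]
  congr 1
  refine Finset.prod_congr rfl fun t ht => ?_
  have ht := Finset.mem_range.1 ht
  have h1 : (r * t + j % r) / r = t := by
    rw [Nat.mul_add_div hr, Nat.div_eq_of_lt (Nat.mod_lt _ hr), add_zero]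
  have h2 : Q ^ y = Q ^ t * Q ^ (y - t) := by rw [← pow_add, Nat.add_sub_cancel' ht.le]
  rw [h1, ← hy, h2]
  ring

lemma prod_rowFactor_id (hq0 : 0 < q) (hq1 : q < 1) (ha : a < r)
    (hN : N % r = 0 ∨ N % r = a)
    (hv : ∀ n : ℕ, (q : ℂ) ^ ((r : ℂ) * (v + n + 1)) ≠ 1) :
    ∏ j ∈ Finset.range N, rowFactor q r a u v N id j =
      1 / (2 * (Real.pi : ℂ)) ^ N *
        ((q ^ r : ℝ) : ℂ) ^ nrN r a u N * ((r : ℂ) / qNumber q r) ^ N *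
        ∏ I ∈ Finset.range N,
          (qGamma (q ^ r) (fl r I a + (a : ℂ) / r + u + 1) *
            qGamma (q ^ r) (fl r I 0 + v + 1) * qGamma (q ^ r) (fl r I 0 + 1) /
            qGamma (q ^ r) (fl r (N + I) a + (a : ℂ) / r + u + v + 1)) := by
  have hr : 0 < r := by omega
  have hrC : (r : ℂ) ≠ 0 := by exact_mod_cast hr.ne'
  have hQ0 := pow_pos hq0 r
  have hQ1 := pow_lt_one₀ hq0.le hq1 hr.ne'
  have hQ := ofReal_pos_ne_zero hQ0
  set Q := ((q ^ r : ℝ) : ℂ) with hQdef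
  have hL : 1 - Q ≠ 0 := one_sub_ne_zero hQ1
  have hQi : qPochInf (q ^ r) Q ≠ 0 := qPochInf_self_ne_zero hQ0 hQ1
  have hterm : ∀ I : ℕ, rowFactor q r a u v N id I =
      (r * ((1 - (q : ℂ)) / (2 * (Real.pi : ℂ)))) *
      (Q ^ ((((I / r : ℕ) : ℂ) * ((nextCongr r a (I % r) : ℂ) + r * u) +
        2 * r * ((I / r).choose 2 : ℂ)) / r)) *
      (1 - Q) ^ (-((classCard r N (I % r) : ℂ) - 2 * ((I / r : ℕ) : ℂ))) *
      (qGamma (q ^ r) (fl r I a + (a : ℂ) / r + u + 1) *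
            qGamma (q ^ r) (fl r I 0 + v + 1) * qGamma (q ^ r) (fl r I 0 + 1) /
            qGamma (q ^ r) (fl r (N + I) a + (a : ℂ) / r + u + v + 1)) := fun I => by
    have g2 := qGamma_natCast_add hQ0 hQ1 (I / r) v (pow_mul_cpow_ne_one hq0 hv)
    have g3 := qGamma_natCast_add hQ0 hQ1 (I / r) 0 (by
      intro i
      rw [zero_add, Complex.cpow_one]
      exact pow_mul_ne_one hQ0 hQ1 (norm_ofReal_lt_one hQ0 hQ1) i)
    rw [zero_add, Complex.cpow_one, add_zero, ← hQdef, div_self hQi, one_mul] at g3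
    have hcc : (nextCongr r a (N + I) : ℂ) / r = (nextCongr r a I : ℂ) / r + classCard r N (I % r) := by
      rw [add_comm N, ← mul_classCard ha hN]
      push_cast
      field_simp
    have hpow : (1 - Q) ^ (-((classCard r N (I % r) : ℂ) - 2 * ((I / r : ℕ) : ℂ))) *
        ((1 - Q) ^ (-((nextCongr r a I : ℂ) / r + u - 1)) * (1 - Q) ^ (-(((I / r : ℕ) : ℂ) + v)) *
          (1 - Q) ^ (-((I / r : ℕ) : ℂ)) *
          ((1 - Q) ^ (-((nextCongr r a (N + I) : ℂ) / r + (u + v) - 1)))⁻¹) = 1 := by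
      rw [← Complex.cpow_neg, ← Complex.cpow_add _ _ hL, ← Complex.cpow_add _ _ hL,
        ← Complex.cpow_add _ _ hL, ← Complex.cpow_add _ _ hL, hcc]
      convert Complex.cpow_zero _ using 2
      ring
    rw [rowFactor_id hq0 hr, fl_zero, add_assoc _ u v, qGamma_fl hq0 ha, qGamma_fl hq0 ha, g2, g3,
      momentConst, add_comm I N, mul_add (r : ℂ) u v]
    simp only [← hQdef]
    generalize (1 - Q) ^ (-((classCard r N (I % r) : ℂ) - 2 * ((I / r : ℕ) : ℂ))) = x0 at *
    generalize (1 - Q) ^ (-((nextCongr r a I : ℂ) / r + u - 1)) = x1 at *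
    generalize (1 - Q) ^ (-(((I / r : ℕ) : ℂ) + v)) = x2 at *
    generalize (1 - Q) ^ (-((I / r : ℕ) : ℂ)) = x3 at *
    generalize (1 - Q) ^ (-((nextCongr r a (N + I) : ℂ) / r + (u + v) - 1)) = x4 at *
    generalize (∏ t ∈ Finset.range (I / r), (1 - Q ^ (v + 1) * Q ^ t)) = y1
    generalize (∏ t ∈ Finset.range (I / r), (1 - Q * Q ^ t)) = y2
    generalize tailProd q r a (r * u + r * v) (N + I) = t2
    generalize tailProd q r a (r * u) I = t1
    generalize qPochInf (q ^ r) (Q ^ (v + 1)) = p2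
    generalize qPochInf (q ^ r) Q = p1 at *
    generalize Q ^ ((((I / r : ℕ) : ℂ) * ((nextCongr r a (I % r) : ℂ) + r * u) +
        2 * r * ((I / r).choose 2 : ℂ)) / r) = z
    have hp : p1 * p1⁻¹ = 1 := mul_inv_cancel₀ hQi
    simp only [div_eq_mul_inv, mul_inv, inv_inv]
    linear_combination (-(r * ((1 - (q : ℂ)) * ((2 : ℂ)⁻¹ * (Real.pi : ℂ)⁻¹)) *
      p1 * p2⁻¹ * t2 * t1⁻¹ * z * y1 * y2)) * hpow
      - (r * ((1 - (q : ℂ)) * ((2 : ℂ)⁻¹ * (Real.pi : ℂ)⁻¹)) *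
      p1 * p2⁻¹ * t2 * t1⁻¹ * z * y1 * y2) * (x0 * (x1 * x2 * x3 * x4⁻¹)) * hp
  rw [Finset.prod_congr rfl fun I _ => hterm I, Finset.prod_mul_distrib, Finset.prod_mul_distrib,
    Finset.prod_mul_distrib, prod_cpow hQ, prod_cpow hL, Finset.sum_neg_distrib,
    sum_classCard_sub hr, ← Finset.sum_div, ← nrN_eq ha, mul_div_cancel_left₀ _ hrC,
    Complex.cpow_neg, Complex.cpow_natCast, Finset.prod_const, Finset.card_range]
  have hqn : qNumber q r = (1 - Q) / (1 - (q : ℂ)) := by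
    rw [qNumber, Complex.cpow_natCast, hQdef]; push_cast; rfl
  have hq1' : (1 : ℂ) - q ≠ 0 := one_sub_ne_zero hq1
  rw [hqn]
  congr 1
  have hpi : (Real.pi : ℂ) ≠ 0 := by exact_mod_cast Real.pi_ne_zero
  simp only [div_pow, mul_pow]
  field_simp

lemma Z_eq (hq0 : 0 < q) (hq1 : q < 1) (ha : a < r) (hu : -1 < (r : ℝ) * u.re)
    (hv : ∀ n : ℕ, (q : ℂ) ^ ((r : ℂ) * (v + n + 1)) ≠ 1) :
    Z q r a u v N =
      (deltaN r a N : ℂ) / (2 * (Real.pi : ℂ)) ^ N *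
        ((q ^ r : ℝ) : ℂ) ^ nrN r a u N * ((r : ℂ) / qNumber q r) ^ N *
        ∏ I ∈ Finset.range N,
          (qGamma (q ^ r) (fl r I a + (a : ℂ) / r + u + 1) *
            qGamma (q ^ r) (fl r I 0 + v + 1) * qGamma (q ^ r) (fl r I 0 + 1) /
            qGamma (q ^ r) (fl r (N + I) a + (a : ℂ) / r + u + v + 1)) := by
  rw [Z_eq_momentDet hq0 hq1 (by omega) hu hv]
  by_cases hN : N % r = 0 ∨ N % r = a
  · rw [momentDet_eq_sign_mul hq0 hq1 ha hN hu ⊥ 1 id (fun _ _ => rfl) (fun i => by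
        rw [betaSet_bot]; simp [Fin.val_rev]), prod_rowFactor_id hq0 hq1 ha hN hv]
    simp only [Equiv.Perm.sign_one, Units.val_one, Int.cast_one]
    ring
  · rw [momentDet_bot_eq_zero ha hN, deltaN, if_neg hN]
    simp

end PartitionFunction

section Residues

variable {r N : ℕ} {l : YoungDiagram}

lemma rowLen_eq_zero {I : ℕ} (hI : l.colLen 0 ≤ I) : l.rowLen I = 0 := by
  by_contra h
  have := YoungDiagram.mem_iff_lt_colLen.1
    (YoungDiagram.mem_iff_lt_rowLen.2 (Nat.pos_of_ne_zero h))
  omega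

lemma natCast_residue (hr : 0 < r) (l : YoungDiagram) (I : ℕ) :
    (residue r l I : ℤ) = ((I : ℤ) - l.rowLen I) % (r : ℤ) :=
  Int.toNat_of_nonneg (Int.emod_nonneg _ (by exact_mod_cast hr.ne'))

lemma residue_lt (hr : 0 < r) (l : YoungDiagram) (I : ℕ) : residue r l I < r := by
  have h := natCast_residue hr l I
  have h2 := Int.emod_lt_of_pos ((I : ℤ) - l.rowLen I) (by exact_mod_cast hr : (0 : ℤ) < r)
  omega

lemma residue_eq_mod (hr : 0 < r) {I : ℕ} (hI : l.colLen 0 ≤ I) : residue r l I = I % r := by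
  have h := natCast_residue hr l I
  rw [rowLen_eq_zero hI] at h
  zify
  simpa using h

lemma colLen_bot : (⊥ : YoungDiagram).colLen 0 = 0 := by
  by_contra h
  exact YoungDiagram.notMem_bot _ (YoungDiagram.mem_iff_lt_colLen.2 (Nat.pos_of_ne_zero h))

lemma natCast_betaSet {I : ℕ} (hI : I < N) :
    (betaSet N l I : ℤ) = N - 1 - I + l.rowLen I := by
  rw [betaSet]; omega

lemma betaSet_mod (hr : 0 < r) {I : ℕ} (hI : I < N) :
    betaSet N l I % r = gapTo r N (residue r l I) := by
  have h : residue r l I + betaSet N l I + 1 ≡ N % r [MOD r] := by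
    rw [← Int.natCast_modEq_iff]
    have h1 : ((residue r l I : ℕ) : ℤ) ≡ I - l.rowLen I [ZMOD r] := by
      rw [natCast_residue hr]; exact Int.mod_modEq _ _
    have h2 := (h1.add_right (betaSet N l I : ℤ)).add_right 1
    rw [natCast_betaSet hI] at h2
    push_cast
    rw [natCast_betaSet hI]
    refine h2.trans ?_
    have e : (I : ℤ) - l.rowLen I + (N - 1 - I + l.rowLen I) + 1 = N := by ring
    rw [e]
    exact (Int.mod_modEq _ _).symm
  rw [add_add_one_modEq_iff (Nat.mod_lt N hr), gapTo_mod] at h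
  exact h

lemma gapTo_inj (hr : 0 < r) {μ ν : ℕ} (hμ : μ < r) (hν : ν < r) :
    gapTo r N μ = gapTo r N ν ↔ μ = ν := by
  constructor
  · intro h
    have h2 := congrArg (gapTo r N) h
    rw [← gapTo_mod r N, ← gapTo_mod r N, gapTo_gapTo (Nat.mod_lt N hr) hμ,
      ← gapTo_mod r N, ← gapTo_mod r N ν, gapTo_gapTo (Nat.mod_lt N hr) hν] at h2
    exact h2
  · rintro rfl; rfl

lemma betaSet_mod_eq_iff (hr : 0 < r) {I J : ℕ} (hI : I < N) (hJ : J < N) :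
    betaSet N l I % r = betaSet N l J % r ↔ residue r l I = residue r l J := by
  rw [betaSet_mod hr hI, betaSet_mod hr hJ, gapTo_inj hr (residue_lt hr l I) (residue_lt hr l J)]

lemma card_betaSet_eq_count (hr : 0 < r) {μ : ℕ} (hμ : μ < r) :
    ((Finset.range N).filter fun i => betaSet N l i % r = gapTo r N μ).card =
      Nat.count (fun I => residue r l I = μ) N := by
  rw [Nat.count_eq_card_filter_range]
  congr 1
  refine Finset.filter_congr fun i hi => ?_
  rw [betaSet_mod hr (Finset.mem_range.1 hi), gapTo_inj hr (residue_lt hr l i) hμ]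

lemma classCard_eq_count (hr : 0 < r) {μ : ℕ} (hμ : μ < r) (N : ℕ) :
    classCard r N μ = Nat.count (fun I => I % r = μ) N := by
  rw [Nat.count_eq_card_filter_range, card_filter_mod_eq hr hμ]

lemma count_residue_add (hr : 0 < r) {μ M : ℕ} (hμ : μ < r) (hM : l.colLen 0 ≤ M) :
    Nat.count (fun I => residue r l I = μ) M + classCard r (l.colLen 0) μ =
      Nat.count (fun I => residue r l I = μ) (l.colLen 0) + classCard r M μ := by
  rw [classCard_eq_count hr hμ, classCard_eq_count hr hμ]
  induction M, hM using Nat.le_induction with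
  | base => ring
  | succ M hM ih =>
    rw [Nat.count_succ, Nat.count_succ, residue_eq_mod hr hM]
    omega

/-- The residue classes of the indices are as large as for the empty partition. -/
def ResidueBalanced (r : ℕ) (l : YoungDiagram) : Prop :=
  ∀ μ < r, Nat.count (fun I => residue r l I = μ) (l.colLen 0) = classCard r (l.colLen 0) μ

lemma residueBalanced_iff (hr : 0 < r) (hN : l.colLen 0 ≤ N) : ResidueBalanced r l ↔
    ∀ μ < r, Nat.count (fun I => residue r l I = μ) N = classCard r N μ := by
  refine forall₂_congr fun μ hμ => ?_
  have := count_residue_add hr hμ hN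
  omega

lemma classCard_self (hr : 0 < r) (I : ℕ) : classCard r I (I % r) = I / r := by
  rw [classCard_eq hr (Nat.mod_lt I hr), if_neg (lt_irrefl _), add_zero]

lemma sigmaHat_mod (hr : 0 < r) (I : ℕ) : sigmaHat r l I % r = residue r l I := by
  rw [sigmaHat, Nat.mul_add_mod, Nat.mod_eq_of_lt (residue_lt hr l I)]

lemma sigmaHat_div (hr : 0 < r) (I : ℕ) :
    sigmaHat r l I / r = Nat.count (fun J => residue r l J = residue r l I) I := by
  rw [sigmaHat, Nat.mul_add_div hr, Nat.div_eq_of_lt (residue_lt hr l I), add_zero]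

lemma sigmaHat_eq_self (hr : 0 < r) (hl : ResidueBalanced r l) {I : ℕ} (hI : l.colLen 0 ≤ I) :
    sigmaHat r l I = I := by
  rw [sigmaHat, residue_eq_mod hr hI, (residueBalanced_iff hr hI).1 hl _ (Nat.mod_lt I hr),
    classCard_self hr, Nat.div_add_mod]

lemma finite_sigmaHat_ne_iff (hr : 0 < r) :
    {I : ℕ | sigmaHat r l I ≠ I}.Finite ↔ ResidueBalanced r l := by
  constructor
  · intro hf μ hμ
    obtain ⟨K, hK⟩ := hf.bddAbove
    set I := r * (K + l.colLen 0 + 1) + μ with hI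
    have h1 : I % r = μ := by rw [hI, Nat.mul_add_mod, Nat.mod_eq_of_lt hμ]
    have h2 : K + l.colLen 0 + 1 ≤ I :=
      (Nat.le_mul_of_pos_left _ hr).trans (Nat.le_add_right _ _)
    have h3 : sigmaHat r l I = I := by
      by_contra hne
      have := hK hne
      omega
    have h4 : l.colLen 0 ≤ I := by omega
    have h5 := sigmaHat_div (l := l) hr I
    rw [h3, residue_eq_mod hr h4, h1] at h5
    have h6 := count_residue_add hr hμ h4
    have h7 := classCard_self hr I
    rw [h1] at h7
    omega
  · intro h
    refine (Set.finite_lt_nat (l.colLen 0)).subset fun I hI => ?_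
    by_contra hc
    exact hI (sigmaHat_eq_self hr h (not_lt.1 hc))

lemma sigmaHat_injective (hr : 0 < r) (l : YoungDiagram) : Function.Injective (sigmaHat r l) := by
  intro I J h
  have h1 := congrArg (· % r) h
  have h2 := congrArg (· / r) h
  simp only [sigmaHat_mod hr, sigmaHat_div hr] at h1 h2
  rw [h1] at h2
  exact Nat.count_injective (p := fun K => residue r l K = residue r l J) h1 rfl h2

lemma sigmaHat_lt (hr : 0 < r) (hl : ResidueBalanced r l) (hN : l.colLen 0 ≤ N) {I : ℕ}
    (hI : I < N) : sigmaHat r l I < N := by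
  rw [sigmaHat, ← lt_classCard_iff hr (residue_lt hr l I),
    ← (residueBalanced_iff hr hN).1 hl _ (residue_lt hr l I)]
  exact Nat.count_strict_mono (p := fun J => residue r l J = residue r l I) rfl hI

lemma sigmaHat_lt_sigmaHat (hr : 0 < r) {I J : ℕ} (h : residue r l I = residue r l J)
    (hIJ : I < J) : sigmaHat r l I < sigmaHat r l J := by
  rw [sigmaHat, sigmaHat, h]
  have := Nat.count_strict_mono (p := fun K => residue r l K = residue r l J) h hIJ
  have := (Nat.mul_lt_mul_left hr).2 this
  omega

/-- The permutation `sigmaHat` of the indices below `N`. -/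
noncomputable def sigmaPerm (hr : 0 < r) (hl : ResidueBalanced r l) (hN : l.colLen 0 ≤ N) :
    Equiv.Perm (Fin N) :=
  Equiv.ofBijective (fun I => ⟨sigmaHat r l I, sigmaHat_lt hr hl hN I.2⟩)
    (Finite.injective_iff_bijective.1 fun _ _ h =>
      Fin.ext (sigmaHat_injective hr l (congrArg Fin.val h)))

lemma val_sigmaPerm (hr : 0 < r) (hl : ResidueBalanced r l) (hN : l.colLen 0 ≤ N) (I : Fin N) :
    (sigmaPerm hr hl hN I : ℕ) = sigmaHat r l I := rfl

lemma exists_sigmaHat_eq (hr : 0 < r) (hl : ResidueBalanced r l) (hN : l.colLen 0 ≤ N) {J : ℕ}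
    (hJ : J < N) : ∃ I < N, sigmaHat r l I = J := by
  obtain ⟨I, hI⟩ := (sigmaPerm hr hl hN).surjective ⟨J, hJ⟩
  exact ⟨I, I.2, congrArg Fin.val hI⟩

lemma sign_sigmaPerm (hr : 0 < r) (hl : ResidueBalanced r l) (hN : l.colLen 0 ≤ N) :
    ((Equiv.Perm.sign (sigmaPerm hr hl hN) : ℤˣ) : ℤ) = rSignature r l := by
  rw [rSignature, if_pos ((finite_sigmaHat_ne_iff hr).2 hl)]
  have hset : {p : ℕ × ℕ | p.1 < p.2 ∧ sigmaHat r l p.2 < sigmaHat r l p.1} =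
      ((Finset.range N ×ˢ Finset.range N).filter fun p : ℕ × ℕ =>
        p.1 < p.2 ∧ sigmaHat r l p.2 < sigmaHat r l p.1 : Finset (ℕ × ℕ)) := by
    ext ⟨i, j⟩
    simp only [Set.mem_ofPred_eq, Finset.coe_filter, Finset.mem_product, Finset.mem_range]
    constructor
    · rintro ⟨h1, h2⟩
      have hj : j < N := by
        by_contra hc
        rw [sigmaHat_eq_self hr hl (hN.trans (not_lt.1 hc))] at h2
        rcases lt_or_ge i N with hi | hi
        · have := sigmaHat_lt hr hl hN hi; omega
        · rw [sigmaHat_eq_self hr hl (hN.trans hi)] at h2; omega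
      exact ⟨⟨h1.trans hj, hj⟩, h1, h2⟩
    · rintro ⟨_, h⟩; exact h
  rw [hset, Set.ncard_coe_finset, ← Finset.prod_const, Finset.prod_filter, Finset.prod_product_right,
    Equiv.Perm.sign_eq_prod_prod_Iio, ← Fin.prod_univ_eq_prod_range]
  push_cast
  refine Finset.prod_congr rfl fun j _ => ?_
  have e : ∀ i : Fin N, (((if sigmaPerm hr hl hN i < sigmaPerm hr hl hN j then 1 else -1 : ℤˣ)) : ℤ) =
      if sigmaHat r l i < sigmaHat r l j then 1 else -1 := fun i => by
    have : sigmaPerm hr hl hN i < sigmaPerm hr hl hN j ↔ sigmaHat r l i < sigmaHat r l j := Iff.rfl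
    simp only [this]
    split_ifs <;> simp
  simp only [e]
  rw [prod_Iio_eq_prod_range j fun i => if sigmaHat r l i < sigmaHat r l j then (1 : ℤ) else -1]
  have hsub : Finset.range (j : ℕ) ⊆ Finset.range N := Finset.range_subset_range.2 j.2.le
  rw [← Finset.prod_subset hsub]
  · refine Finset.prod_congr rfl fun i hi => ?_
    have hi := Finset.mem_range.1 hi
    have hne : sigmaHat r l i ≠ sigmaHat r l j := fun h => hi.ne (sigmaHat_injective hr l h)
    simp only [hi, true_and]
    split_ifs <;> omega
  · intro i _ hi
    rw [if_neg]
    rw [Finset.mem_range] at hi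
    tauto

lemma idx_sigmaHat (hr : 0 < r) (I : ℕ) :
    idx r l (sigmaHat r l I % r) (sigmaHat r l I / r) = I := by
  rw [idx, sigmaHat_mod hr, sigmaHat_div hr]
  exact Nat.nth_count (p := fun J => residue r l J = residue r l I) rfl

lemma remainder_eq_zero (hr : 0 < r) (hl : ResidueBalanced r l) {μ : ℕ} (hμ : μ < r) :
    remainder r l μ = 0 := by
  set J := r * l.colLen 0 + μ with hJ
  have h1 : J % r = μ := by rw [hJ, Nat.mul_add_mod, Nat.mod_eq_of_lt hμ]
  have h2 : J / r = l.colLen 0 := by rw [hJ, Nat.mul_add_div hr, Nat.div_eq_of_lt hμ, add_zero]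
  have h3 : l.colLen 0 ≤ J := (Nat.le_mul_of_pos_left _ hr).trans (Nat.le_add_right _ _)
  have h4 := idx_sigmaHat (l := l) hr J
  rw [sigmaHat_eq_self hr hl h3, h1, h2] at h4
  rw [remainder, h4, hJ]
  push_cast
  rw [add_sub_cancel_right, Int.mul_ediv_cancel_left _ (by exact_mod_cast hr.ne'), sub_self]

/-- The exponents rearranged by `sigmaHat`, in the order of the indices. -/
noncomputable def sortedBeta (r N : ℕ) (l : YoungDiagram) (J : ℕ) : ℕ :=
  betaSet N l (idx r l (J % r) (J / r))

lemma sortedBeta_sigmaHat (hr : 0 < r) (I : ℕ) :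
    sortedBeta r N l (sigmaHat r l I) = betaSet N l I := by
  rw [sortedBeta, idx_sigmaHat hr]

lemma natCast_sortedBeta (hr : 0 < r) (hl : ResidueBalanced r l) (hN : l.colLen 0 ≤ N) {J : ℕ}
    (hJ : J < N) :
    (sortedBeta r N l J : ℤ) = (N - 1 - J : ℕ) + r * quotientRow r l (J % r) (J / r) := by
  obtain ⟨I, hI, rfl⟩ := exists_sigmaHat_eq hr hl hN hJ
  have hm := sigmaHat_mod (l := l) hr I
  have hd := Nat.div_add_mod (sigmaHat r l I) r
  rw [sortedBeta_sigmaHat hr, quotientRow, remainder_eq_zero hr hl (Nat.mod_lt _ hr),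
    idx_sigmaHat hr, natCast_betaSet hI, hm]
  rw [hm] at hd
  have h1 : (r : ℤ) ∣ (l.rowLen I : ℤ) - I + residue r l I := by
    rw [natCast_residue hr, Int.emod_def]
    exact ⟨-(((I : ℤ) - l.rowLen I) / r), by ring⟩
  have h2 := Int.mul_ediv_cancel' h1
  have h3 : (r : ℤ) * ((sigmaHat r l I / r : ℕ) : ℤ) + residue r l I = sigmaHat r l I := by
    exact_mod_cast hd
  have h4 : ((N - 1 - sigmaHat r l I : ℕ) : ℤ) = N - 1 - sigmaHat r l I := by omega
  rw [h4, sub_zero, mul_add, h2]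
  linarith

lemma quotientRow_eq_zero (hr : 0 < r) (hl : ResidueBalanced r l) {J : ℕ}
    (hJ : l.colLen 0 ≤ J) : quotientRow r l (J % r) (J / r) = 0 := by
  have h := natCast_sortedBeta hr hl (hJ.trans J.le_succ) (Nat.lt_succ_self J)
  have h1 := sortedBeta_sigmaHat (N := J + 1) (l := l) hr J
  rw [sigmaHat_eq_self hr hl hJ] at h1
  rw [Nat.succ_eq_add_one, h1, betaSet, rowLen_eq_zero hJ] at h
  simpa [hr.ne'] using h

lemma nrPart_eq (hr : 0 < r) (hl : ResidueBalanced r l) (hN : l.colLen 0 ≤ N) :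
    nrPart r l = ∑ J ∈ Finset.range N, ((J / r : ℕ) : ℤ) * quotientRow r l (J % r) (J / r) := by
  set f : ℕ → ℤ := fun J => ((J / r : ℕ) : ℤ) * quotientRow r l (J % r) (J / r) with hf
  have h0 : ∀ J, l.colLen 0 ≤ J → f J = 0 := fun J hJ => by
    simp only [hf]
    rw [quotientRow_eq_zero hr hl hJ, mul_zero]
  have h1 : ∀ M, l.colLen 0 ≤ M → ∑ J ∈ Finset.range M, f J =
      ∑ J ∈ Finset.range (l.colLen 0), f J := fun M hM => by
    refine (Finset.sum_subset (Finset.range_subset_range.2 hM) fun J _ hJ => h0 J ?_).symm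
    simpa using hJ
  rw [h1 N hN, ← h1 (r * l.colLen 0) (Nat.le_mul_of_pos_left _ hr),
    sum_range_eq_sum_classes hr, nrPart, ← Fin.sum_univ_eq_sum_range
      (fun μ => ∑ i ∈ Finset.range (l.colLen 0), (i : ℤ) * quotientRow r l μ i)]
  refine Finset.sum_congr rfl fun ν _ => ?_
  have hc : classCard r (r * l.colLen 0) ν = l.colLen 0 := by
    rw [classCard, Nat.mul_add_div hr, Nat.div_eq_of_lt (by omega), add_zero]
  rw [hc]
  refine Finset.sum_congr rfl fun y _ => ?_
  simp only [hf, Nat.mul_add_mod, Nat.mod_eq_of_lt ν.2, Nat.mul_add_div hr,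
    Nat.div_eq_of_lt ν.2, add_zero]

end Residues

section Pairs

variable {r N : ℕ} {l : YoungDiagram}

/-- The pairs `I < J < N` on which `ρ` takes the same value. -/
def levelPairs (N : ℕ) (ρ : ℕ → ℕ) : Finset (ℕ × ℕ) :=
  (Finset.range N ×ˢ Finset.range N).filter fun p => p.1 < p.2 ∧ ρ p.1 = ρ p.2

lemma mem_levelPairs {ρ : ℕ → ℕ} {p : ℕ × ℕ} :
    p ∈ levelPairs N ρ ↔ p.2 < N ∧ p.1 < p.2 ∧ ρ p.1 = ρ p.2 := by
  simp only [levelPairs, Finset.mem_filter, Finset.mem_product, Finset.mem_range]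
  constructor
  · rintro ⟨⟨_, h1⟩, h2⟩; exact ⟨h1, h2⟩
  · rintro ⟨h1, h2, h3⟩; exact ⟨⟨h2.trans h1, h1⟩, h2, h3⟩

lemma prod_levelPairs_mod {M : Type*} [CommMonoid M] (hr : 0 < r) (g : ℕ → ℕ → M) :
    ∏ p ∈ levelPairs N (· % r), g p.1 p.2 =
      ∏ j ∈ Finset.range N, ∏ t ∈ Finset.range (j / r), g (r * t + j % r) j := by
  rw [levelPairs, Finset.prod_filter, Finset.prod_product_right]
  refine Finset.prod_congr rfl fun j hj => ?_
  have hj := Finset.mem_range.1 hj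
  have hjd := Nat.div_add_mod j r
  rw [← Finset.prod_filter]
  symm
  refine Finset.prod_nbij' (fun t => r * t + j % r) (fun i => i / r) ?_ ?_ ?_ ?_ fun _ _ => rfl
  · intro t ht
    have ht := Finset.mem_range.1 ht
    have h1 : r * (t + 1) ≤ r * (j / r) := Nat.mul_le_mul_left r ht
    rw [mul_add, mul_one] at h1
    simp only [Finset.mem_filter, Finset.mem_range, Nat.mul_add_mod, Nat.mod_mod, and_true]
    omega
  · intro i hi
    simp only [Finset.mem_filter, Finset.mem_range] at hi ⊢
    obtain ⟨_, h1, h2⟩ := hi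
    have h3 := Nat.div_add_mod i r
    rw [h2] at h3
    exact (Nat.mul_lt_mul_left hr).1 (by omega)
  · intro t _
    rw [Nat.mul_add_div hr, Nat.div_eq_of_lt (Nat.mod_lt _ hr), add_zero]
  · intro i hi
    simp only [Finset.mem_filter, Finset.mem_range] at hi
    have h3 := Nat.div_add_mod i r
    rw [← hi.2.2, h3]

lemma reflect_mod_eq {i j : ℕ} (hi : i < N) (hj : j < N) (h : i % r = j % r) :
    (N - 1 - i) % r = (N - 1 - j) % r := by
  refine Nat.ModEq.add_right_cancel (n := r) (c := i) (d := j) h ?_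
  have : N - 1 - i + i = N - 1 - j + j := by omega
  rw [this]

lemma prod_levelPairs_reflect {M : Type*} [CommMonoid M] (g : ℕ → ℕ → M) :
    ∏ p ∈ levelPairs N (· % r), g p.1 p.2 =
      ∏ p ∈ levelPairs N (· % r), g (N - 1 - p.2) (N - 1 - p.1) := by
  have hmem : ∀ p ∈ levelPairs N (· % r), (N - 1 - p.2, N - 1 - p.1) ∈ levelPairs N (· % r) := by
    intro p hp
    rw [mem_levelPairs] at hp ⊢
    obtain ⟨h1, h2, h3⟩ := hp
    exact ⟨by simp only; omega, by simp only; omega, reflect_mod_eq h1 (h2.trans h1) h3.symm⟩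
  have hinv : ∀ p ∈ levelPairs N (· % r), (N - 1 - (N - 1 - p.1), N - 1 - (N - 1 - p.2)) = p := by
    intro p hp
    rw [mem_levelPairs] at hp
    ext <;> simp only <;> omega
  refine Finset.prod_nbij' (fun p => (N - 1 - p.2, N - 1 - p.1))
    (fun p => (N - 1 - p.2, N - 1 - p.1)) hmem hmem hinv hinv ?_
  intro p hp
  have := hinv p hp
  rw [Prod.ext_iff] at this
  simp only at this
  simp only [this]

lemma prod_levelPairs_sigmaHat {M : Type*} [CommMonoid M] (hr : 0 < r) (hl : ResidueBalanced r l)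
    (hN : l.colLen 0 ≤ N) (g : ℕ → ℕ → M) :
    ∏ p ∈ levelPairs N (residue r l), g (sigmaHat r l p.1) (sigmaHat r l p.2) =
      ∏ p ∈ levelPairs N (· % r), g p.1 p.2 := by
  refine Finset.prod_bij (fun p _ => (sigmaHat r l p.1, sigmaHat r l p.2)) ?_ ?_ ?_ fun _ _ => rfl
  · intro p hp
    rw [mem_levelPairs] at hp ⊢
    obtain ⟨h1, h2, h3⟩ := hp
    refine ⟨sigmaHat_lt hr hl hN h1, sigmaHat_lt_sigmaHat hr h3 h2, ?_⟩
    simp only [sigmaHat_mod hr, h3]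
  · intro p _ p' _ h
    rw [Prod.mk.injEq] at h
    exact Prod.ext (sigmaHat_injective hr l h.1) (sigmaHat_injective hr l h.2)
  · intro p hp
    rw [mem_levelPairs] at hp
    obtain ⟨h1, h2, h3⟩ := hp
    obtain ⟨I, hI, hI'⟩ := exists_sigmaHat_eq hr hl hN (h2.trans h1)
    obtain ⟨J, hJ, hJ'⟩ := exists_sigmaHat_eq hr hl hN h1
    rw [← hI', ← hJ'] at h2
    have h4 : residue r l I = residue r l J := by
      rw [← sigmaHat_mod hr I, ← sigmaHat_mod hr J, hI', hJ']; exact h3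
    refine ⟨(I, J), mem_levelPairs.2 ⟨hJ, ?_, h4⟩, Prod.ext hI' hJ'⟩
    by_contra hc
    rcases (not_lt.1 hc).eq_or_lt with h | h
    · simp only at h; rw [h] at h2; exact lt_irrefl _ h2
    · exact lt_asymm h2 (sigmaHat_lt_sigmaHat hr h4.symm h)

lemma prod_betaSet_eq_prod_sortedBeta {M : Type*} [CommMonoid M] (hr : 0 < r)
    (hl : ResidueBalanced r l) (hN : l.colLen 0 ≤ N) (f : ℕ → M) :
    ∏ I ∈ Finset.range N, f (betaSet N l I) = ∏ J ∈ Finset.range N, f (sortedBeta r N l J) := by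
  rw [← Fin.prod_univ_eq_prod_range (fun I => f (betaSet N l I)),
    ← Fin.prod_univ_eq_prod_range (fun J => f (sortedBeta r N l J)),
    ← Equiv.prod_comp (sigmaPerm hr hl hN) fun J : Fin N => f (sortedBeta r N l J)]
  refine Finset.prod_congr rfl fun I _ => ?_
  rw [val_sigmaPerm, sortedBeta_sigmaHat hr]

lemma sortedBeta_mod (hr : 0 < r) (hl : ResidueBalanced r l) (hN : l.colLen 0 ≤ N) {J : ℕ}
    (hJ : J < N) : sortedBeta r N l J % r = (N - 1 - J) % r := by
  have h := natCast_sortedBeta hr hl hN hJ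
  have : (sortedBeta r N l J : ℤ) % r = ((N - 1 - J : ℕ) : ℤ) % r := by
    rw [h, Int.add_mul_emod_self_left]
  exact_mod_cast this

lemma sortedBeta_div (hr : 0 < r) (hl : ResidueBalanced r l) (hN : l.colLen 0 ≤ N) {J : ℕ}
    (hJ : J < N) : ((sortedBeta r N l J / r : ℕ) : ℤ) =
      ((N - 1 - J) / r : ℕ) + quotientRow r l (J % r) (J / r) := by
  have h := natCast_sortedBeta hr hl hN hJ
  rw [Int.natCast_div, h, Int.add_mul_ediv_left _ _ (by exact_mod_cast hr.ne'), Int.natCast_div]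

end Pairs

section DeterminantFormula

variable {q : ℝ} {r a N : ℕ} {u v : ℂ} {l : YoungDiagram}

/-- The product of `1 - q^{p_I - p_J}` over the pairs of congruent exponents. -/
noncomputable def congruentDiff (q : ℝ) (r N : ℕ) (l : YoungDiagram) : ℂ :=
  ∏ p ∈ levelPairs N (residue r l),
    (1 - (q : ℂ) ^ ((betaSet N l p.1 : ℂ) - (betaSet N l p.2 : ℂ)))

/-- The power of `q^r` in the determinant of moments. -/
noncomputable def powerFactor (q : ℝ) (r N : ℕ) (l : YoungDiagram) : ℂ :=
  ∏ J ∈ Finset.range N, (((q ^ r : ℝ) : ℂ) ^ (sortedBeta r N l J / r)) ^ (J / r)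

/-- The product of the infinite products in the determinant of moments. -/
noncomputable def tailFactor (q : ℝ) (r a : ℕ) (u v : ℂ) (N : ℕ) (l : YoungDiagram) : ℂ :=
  ∏ I ∈ Finset.range N, (tailProd q r a (r * u + r * v) (betaSet N l I + N) /
    tailProd q r a (r * u) (betaSet N l I))

/-- The part of the determinant of moments that does not depend on the partition. -/
noncomputable def commonFactor (q : ℝ) (r a : ℕ) (u v : ℂ) (N : ℕ) : ℂ :=
  ∏ j ∈ Finset.range N, (momentConst q r v * ∏ t ∈ Finset.range (j / r),
      ((1 - ((q ^ r : ℝ) : ℂ) ^ (v + 1) * ((q ^ r : ℝ) : ℂ) ^ t) *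
        ((q : ℂ) ^ ((nextCongr r a (j % r) : ℂ) + r * u) * ((q ^ r : ℝ) : ℂ) ^ t)))

lemma prod_pow_sub_pow_eq (hq0 : 0 < q) (hr : 0 < r) (hl : ResidueBalanced r l)
    (hN : l.colLen 0 ≤ N) :
    ∏ j ∈ Finset.range N, ∏ t ∈ Finset.range (j / r),
      (((q ^ r : ℝ) : ℂ) ^ (sortedBeta r N l (N - 1 - (r * t + j % r)) / r) -
        ((q ^ r : ℝ) : ℂ) ^ (sortedBeta r N l (N - 1 - j) / r)) =
    powerFactor q r N l * congruentDiff q r N l := by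
  have hq := ofReal_pos_ne_zero hq0
  rw [← prod_levelPairs_mod (N := N) hr fun i j =>
      ((q ^ r : ℝ) : ℂ) ^ (sortedBeta r N l (N - 1 - i) / r) -
        ((q ^ r : ℝ) : ℂ) ^ (sortedBeta r N l (N - 1 - j) / r),
    prod_levelPairs_reflect fun i j =>
      ((q ^ r : ℝ) : ℂ) ^ (sortedBeta r N l (N - 1 - i) / r) -
        ((q ^ r : ℝ) : ℂ) ^ (sortedBeta r N l (N - 1 - j) / r)]
  have e : ∀ p ∈ levelPairs N (· % r),
      ((q ^ r : ℝ) : ℂ) ^ (sortedBeta r N l (N - 1 - (N - 1 - p.2)) / r) -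
        ((q ^ r : ℝ) : ℂ) ^ (sortedBeta r N l (N - 1 - (N - 1 - p.1)) / r) =
      ((q ^ r : ℝ) : ℂ) ^ (sortedBeta r N l p.2 / r) *
        (1 - (q : ℂ) ^ ((sortedBeta r N l p.1 : ℂ) - (sortedBeta r N l p.2 : ℂ))) := by
    intro p hp
    obtain ⟨h1, h2, h3⟩ := mem_levelPairs.1 hp
    have e1 : N - 1 - (N - 1 - p.2) = p.2 := by omega
    have e2 : N - 1 - (N - 1 - p.1) = p.1 := by omega
    have h4 : sortedBeta r N l p.1 % r = sortedBeta r N l p.2 % r := by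
      rw [sortedBeta_mod hr hl hN h1, sortedBeta_mod hr hl hN (h2.trans h1)]
      exact reflect_mod_eq (h2.trans h1) h1 h3
    have d1 := Nat.div_add_mod (sortedBeta r N l p.1) r
    have d2 := Nat.div_add_mod (sortedBeta r N l p.2) r
    rw [h4] at d1
    rw [e1, e2, mul_sub, mul_one, pow_r_mul_eq, pow_r_mul_eq, ← Complex.cpow_add _ _ hq]
    congr 2
    have d1' := congrArg (Nat.cast : ℕ → ℂ) d1
    have d2' := congrArg (Nat.cast : ℕ → ℂ) d2
    push_cast at d1' d2' ⊢
    linear_combination d1' - d2'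
  rw [Finset.prod_congr rfl e, Finset.prod_mul_distrib, powerFactor, congruentDiff]
  congr 1
  · rw [prod_levelPairs_mod hr fun _ j => ((q ^ r : ℝ) : ℂ) ^ (sortedBeta r N l j / r)]
    simp only [Finset.prod_const, Finset.card_range]
  · rw [← prod_levelPairs_sigmaHat hr hl hN fun I J =>
      1 - (q : ℂ) ^ ((sortedBeta r N l I : ℂ) - (sortedBeta r N l J : ℂ))]
    simp only [sortedBeta_sigmaHat hr]

lemma momentDet_eq (hq0 : 0 < q) (hq1 : q < 1) (ha : a < r)
    (hNr : N % r = 0 ∨ N % r = a) (hu : -1 < (r : ℝ) * u.re) (hl : ResidueBalanced r l)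
    (hN : l.colLen 0 ≤ N) :
    momentDet q r a u v N l = (rSignature r l : ℂ) * deltaN r a N *
      (commonFactor q r a u v N * tailFactor q r a u v N l *
        (powerFactor q r N l * congruentDiff q r N l)) := by
  have hr : 0 < r := by omega
  rw [momentDet_eq_sign_mul hq0 hq1 ha hNr hu l (sigmaPerm hr hl hN)
    (fun j => sortedBeta r N l (N - 1 - j)), sign_sigmaPerm hr hl hN]
  · congr 1
    have e : tailFactor q r a u v N l = ∏ j ∈ Finset.range N,
        (tailProd q r a (r * u + r * v) (sortedBeta r N l (N - 1 - j) + N) /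
          tailProd q r a (r * u) (sortedBeta r N l (N - 1 - j))) := by
      rw [tailFactor, prod_betaSet_eq_prod_sortedBeta hr hl hN fun P =>
        tailProd q r a (r * u + r * v) (P + N) / tailProd q r a (r * u) P,
        ← Finset.prod_range_reflect]
    rw [← prod_pow_sub_pow_eq hq0 hr hl hN, e, commonFactor, ← Finset.prod_mul_distrib,
      ← Finset.prod_mul_distrib]
    refine Finset.prod_congr rfl fun j _ => ?_
    rw [rowFactor, Finset.prod_mul_distrib]
    ring
  · intro j hj
    rw [sortedBeta_mod hr hl hN (by omega)]
    congr 1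
    omega
  · intro i
    have h1 : N - 1 - ((Fin.rev (sigmaPerm hr hl hN i) : Fin N) : ℕ) = sigmaHat r l i := by
      have := (sigmaPerm hr hl hN i).2
      rw [val_sigmaPerm] at this
      rw [Fin.val_rev, val_sigmaPerm]
      omega
    simp only [h1]
    exact sortedBeta_sigmaHat hr i

lemma residueBalanced_bot (hr : 0 < r) : ResidueBalanced r ⊥ := by
  intro μ hμ
  rw [classCard_eq_count hr hμ, colLen_bot]
  rfl

lemma rSignature_bot (hr : 0 < r) : rSignature r ⊥ = 1 := by
  have hb := residueBalanced_bot hr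
  rw [← sign_sigmaPerm hr hb (N := 0) (by rw [colLen_bot])]
  simp [Subsingleton.elim (sigmaPerm hr hb (N := 0) _) 1]

lemma powerFactor_eq (hq0 : 0 < q) (hr : 0 < r) (hl : ResidueBalanced r l)
    (hN : l.colLen 0 ≤ N) :
    powerFactor q r N l = powerFactor q r N ⊥ * ((q ^ r : ℝ) : ℂ) ^ nrPart r l := by
  have hQ := ofReal_pos_ne_zero (pow_pos hq0 r)
  have hz : ∀ (s : Finset ℕ) (f : ℕ → ℤ), ((q ^ r : ℝ) : ℂ) ^ (∑ i ∈ s, f i) =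
      ∏ i ∈ s, ((q ^ r : ℝ) : ℂ) ^ f i := fun s f => by
    rw [← Complex.cpow_intCast, Int.cast_sum, ← prod_cpow hQ]
    simp only [Complex.cpow_intCast]
  rw [nrPart_eq hr hl hN, hz, powerFactor, powerFactor, ← Finset.prod_mul_distrib]
  refine Finset.prod_congr rfl fun J hJ => ?_
  have hJ := Finset.mem_range.1 hJ
  have h1 := sortedBeta_div hr hl hN hJ
  have h2 := sortedBeta_div hr (residueBalanced_bot hr) (N := N) (by rw [colLen_bot]; omega) hJ
  rw [quotientRow_eq_zero hr (residueBalanced_bot hr) (by rw [colLen_bot]; omega), add_zero] at h2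
  rw [← h2] at h1
  rw [← zpow_natCast _ (sortedBeta r N l J / r), h1, zpow_add₀ hQ, mul_pow, zpow_natCast, mul_comm
    ((J / r : ℕ) : ℤ), zpow_mul, zpow_natCast]

end DeterminantFormula

section Hooks

variable {q : ℝ} {r a N : ℕ} {l : YoungDiagram}

lemma prod_cells {M : Type*} [CommMonoid M] (hN : l.colLen 0 ≤ N) (f : ℕ × ℕ → M) :
    ∏ x ∈ l.cells, f x =
      ∏ i ∈ Finset.range N, ∏ j ∈ Finset.range (l.rowLen i), f (i, j) := by
  refine Finset.prod_finset_product _ _ _ fun p => ?_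
  rw [YoungDiagram.mem_cells, Finset.mem_range, Finset.mem_range,
    show p ∈ l ↔ (p.1, p.2) ∈ l from Iff.rfl, YoungDiagram.mem_iff_lt_rowLen]
  refine ⟨fun h => ⟨?_, h⟩, fun h => h.2⟩
  by_contra hc
  rw [rowLen_eq_zero (hN.trans (not_lt.1 hc))] at h
  omega

/-- The hook lengths of a row and the differences of the exponents fill up an interval. -/
lemma prod_hook_row {M : Type*} [CommMonoid M] (hN : l.colLen 0 ≤ N) {i : ℕ} (hi : i < N)
    (g : ℤ → M) :
    (∏ j ∈ Finset.range (l.rowLen i), g (hook l (i, j))) *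
      ∏ J ∈ Finset.Ioo i N, g ((betaSet N l i : ℤ) - betaSet N l J) =
      ∏ m ∈ Finset.range (betaSet N l i), g ((m : ℤ) + 1) := by
  have hb := natCast_betaSet (l := l) hi
  have hanti := l.rowLen_anti
  have hcanti := l.colLen_anti
  have hmem : ∀ i j, j < l.rowLen i ↔ i < l.colLen j := fun i j => by
    rw [← YoungDiagram.mem_iff_lt_rowLen, ← YoungDiagram.mem_iff_lt_colLen]
  set A := (Finset.range (l.rowLen i)).image fun j => hook l (i, j) with hA
  set B := (Finset.Ioo i N).image fun J => (betaSet N l i : ℤ) - betaSet N l J with hB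
  set C := (Finset.range (betaSet N l i)).image fun m : ℕ => (m : ℤ) + 1 with hC
  have iA : Set.InjOn (fun j => hook l (i, j)) (Finset.range (l.rowLen i) : Set ℕ) := by
    intro j _ j' _ h
    simp only [hook] at h
    rcases lt_trichotomy j j' with hlt | heq | hlt
    · have := hcanti j j' hlt.le; omega
    · exact heq
    · have := hcanti j' j hlt.le; omega
  have iB : Set.InjOn (fun J => (betaSet N l i : ℤ) - betaSet N l J)
      (Finset.Ioo i N : Set ℕ) := by
    intro J hJ J' hJ' h
    simp only [Finset.coe_Ioo, Set.mem_Ioo] at hJ hJ' h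
    rw [natCast_betaSet hJ.2, natCast_betaSet hJ'.2] at h
    rcases lt_trichotomy J J' with hlt | heq | hlt
    · have := hanti J J' hlt.le; omega
    · exact heq
    · have := hanti J' J hlt.le; omega
  have iC : Set.InjOn (fun m : ℕ => (m : ℤ) + 1) (Finset.range (betaSet N l i) : Set ℕ) := by
    intro m _ m' _ h
    simp only at h
    omega
  have hAB : Disjoint A B := by
    rw [Finset.disjoint_left]
    intro x hx hx'
    obtain ⟨j, hj, rfl⟩ := Finset.mem_image.1 hx
    obtain ⟨J, hJ, h⟩ := Finset.mem_image.1 hx'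
    rw [Finset.mem_Ioo] at hJ
    rw [hb, natCast_betaSet hJ.2] at h
    simp only [hook] at h
    have := hmem J j
    rcases lt_or_ge J (l.colLen j) with h1 | h1 <;> omega
  have hsub : A ∪ B ⊆ C := by
    intro x hx
    have hmemC : ∀ x : ℤ, 0 < x → x ≤ betaSet N l i → x ∈ C := fun x h0 h1 =>
      Finset.mem_image.2 ⟨(x - 1).toNat, Finset.mem_range.2 (by omega), by
        rw [Int.toNat_of_nonneg (by omega)]; ring⟩
    rcases Finset.mem_union.1 hx with hx | hx
    · obtain ⟨j, hj, rfl⟩ := Finset.mem_image.1 hx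
      have hj := Finset.mem_range.1 hj
      have h1 := (hmem i j).1 hj
      have h2 := hcanti 0 j (Nat.zero_le j)
      apply hmemC <;> simp only [hook] <;> omega
    · obtain ⟨J, hJ, rfl⟩ := Finset.mem_image.1 hx
      rw [Finset.mem_Ioo] at hJ
      have h1 := natCast_betaSet (l := l) hJ.2
      have h2 := hanti i J hJ.1.le
      apply hmemC <;> omega
  have hcard : C.card ≤ (A ∪ B).card := by
    rw [Finset.card_union_of_disjoint hAB, Finset.card_image_of_injOn iA,
      Finset.card_image_of_injOn iB, Finset.card_image_of_injOn iC, Finset.card_range,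
      Finset.card_range, Nat.card_Ioo]
    omega
  have hU := Finset.eq_of_subset_of_card_le hsub hcard
  rw [← Finset.prod_image (g := fun j => hook l (i, j)) iA,
    ← Finset.prod_image (g := fun J => (betaSet N l i : ℤ) - betaSet N l J) iB,
    ← Finset.prod_image (g := fun m : ℕ => (m : ℤ) + 1) iC, ← hA, ← hB, ← hC, ← hU,
    Finset.prod_union hAB]

/-- The product over the differences of the exponents. -/
noncomputable def diffProd (N : ℕ) (l : YoungDiagram) (g : ℤ → ℂ) : ℂ :=
  ∏ i ∈ Finset.range N, ∏ J ∈ Finset.Ioo i N, g ((betaSet N l i : ℤ) - betaSet N l J)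

lemma prod_hook_mul_diffProd (hN : l.colLen 0 ≤ N) (g : ℤ → ℂ) :
    (∏ x ∈ l.cells, g (hook l x)) * diffProd N l g =
      diffProd N ⊥ g * ∏ x ∈ l.cells, g (N + content x) := by
  rw [prod_cells hN, prod_cells hN, diffProd, diffProd, ← Finset.prod_mul_distrib,
    ← Finset.prod_mul_distrib]
  refine Finset.prod_congr rfl fun i hi => ?_
  have hi := Finset.mem_range.1 hi
  have h := prod_hook_row (l := ⊥) (N := N) (by rw [colLen_bot]; omega) hi g
  rw [rowLen_bot, Finset.prod_range_zero, one_mul] at h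
  rw [prod_hook_row hN hi g, h, betaSet_bot, betaSet, Finset.prod_range_add]
  congr 1
  refine Finset.prod_congr rfl fun j _ => ?_
  congr 1
  simp only [content]
  omega

lemma bracket_ne_zero_of_pos (hq0 : 0 < q) (hq1 : q < 1) {m : ℤ} (hm : 0 < m) :
    bracket q r a m 0 ≠ 0 := by
  rw [bracket]
  split_ifs
  · rw [qNumber, add_zero]
    refine div_ne_zero (sub_ne_zero.2 fun h => ?_) (one_sub_ne_zero hq1)
    have h1 := congrArg norm h
    rw [norm_one, Complex.norm_cpow_eq_rpow_re_of_pos hq0, Complex.intCast_re] at h1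
    exact (Real.rpow_lt_one hq0.le hq1 (by exact_mod_cast hm)).ne h1.symm
  · exact one_ne_zero

lemma hook_pos {x : ℕ × ℕ} (hx : x ∈ l.cells) : 0 < hook l x := by
  rw [YoungDiagram.mem_cells] at hx
  have h1 := YoungDiagram.mem_iff_lt_rowLen.1 (show (x.1, x.2) ∈ l from hx)
  have h2 := YoungDiagram.mem_iff_lt_colLen.1 (show (x.1, x.2) ∈ l from hx)
  rw [hook]
  omega

lemma diffProd_bracket (hr : 0 < r) (l : YoungDiagram) :
    diffProd N l (fun m => bracket q r 0 m 0) =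
      congruentDiff q r N l / (1 - (q : ℂ)) ^ (levelPairs N (residue r l)).card := by
  rw [congruentDiff, ← Finset.prod_const, ← Finset.prod_div_distrib, levelPairs,
    Finset.prod_filter, Finset.prod_product, diffProd]
  refine Finset.prod_congr rfl fun i hi => ?_
  have hi := Finset.mem_range.1 hi
  have hsub : Finset.Ioo i N ⊆ Finset.range N := fun J hJ =>
    Finset.mem_range.2 (Finset.mem_Ioo.1 hJ).2
  rw [← Finset.prod_subset hsub]
  · refine Finset.prod_congr rfl fun J hJ => ?_
    obtain ⟨h1, h2⟩ := Finset.mem_Ioo.1 hJ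
    have h3 : ((betaSet N l i : ℤ) - betaSet N l J ≡ (0 : ℕ) [ZMOD r]) ↔
        (i < J ∧ residue r l i = residue r l J) := by
      rw [← betaSet_mod_eq_iff hr hi h2, Nat.cast_zero, Int.modEq_zero_iff_dvd,
        ← Int.modEq_iff_dvd, Int.natCast_modEq_iff, and_iff_right h1]
      exact eq_comm
    rw [bracket]
    simp only [h3]
    split_ifs
    · rw [qNumber, add_zero]; push_cast; rfl
    · rfl
  · intro J hJ hJ'
    rw [if_neg]
    rintro ⟨h1, _⟩
    exact hJ' (Finset.mem_Ioo.2 ⟨h1, Finset.mem_range.1 hJ⟩)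

end Hooks

section TailRatio

variable {q : ℝ} {r a N : ℕ} {u v : ℂ} {l : YoungDiagram}

lemma nextCongr_succ_of_modEq (ha : a < r) {P : ℕ} (h : P + 1 ≡ a [MOD r]) :
    nextCongr r a P = P + 1 ∧ nextCongr r a (P + 1) = P + 1 + r := by
  have hr : 0 < r := by omega
  have h1 := (add_add_one_modEq_iff ha P 0).1 h
  have h2 := (add_add_one_modEq_iff ha (P + 1) (r - 1)).1 (by
    have e : P + 1 + (r - 1) + 1 = P + 1 + r := by omega
    rw [e, Nat.ModEq, Nat.add_mod_right]
    exact h)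
  rw [Nat.zero_mod] at h1
  rw [Nat.mod_eq_of_lt (by omega)] at h2
  rw [nextCongr, nextCongr, ← h1, ← h2]
  omega

lemma nextCongr_succ_of_not_modEq (ha : a < r) {P : ℕ} (h : ¬ P + 1 ≡ a [MOD r]) :
    nextCongr r a (P + 1) = nextCongr r a P := by
  have hr : 0 < r := by omega
  have hg := gapTo_lt (a := a) hr (P + 1)
  have h1 := (add_add_one_modEq_iff ha (P + 1) (gapTo r a (P + 1))).2 (Nat.mod_eq_of_lt hg)
  have h2 := (add_add_one_modEq_iff ha P (gapTo r a (P + 1) + 1)).1 (by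
    have e : P + (gapTo r a (P + 1) + 1) + 1 = P + 1 + gapTo r a (P + 1) + 1 := by ring
    rw [e]; exact h1)
  rcases (Nat.succ_le_of_lt hg).eq_or_lt with heq | hlt
  · rw [← Nat.succ_eq_add_one, heq, Nat.mod_self] at h2
    exact absurd ((add_add_one_modEq_iff ha P 0).2 (by rw [Nat.zero_mod, h2])) h
  · rw [Nat.mod_eq_of_lt hlt] at h2
    rw [nextCongr, nextCongr, ← h2]
    omega

/-- `tailProd` with the factors normalized to `q`-numbers, up to a common constant. -/
noncomputable def normTail (q : ℝ) (r a : ℕ) (z : ℂ) (P : ℕ) : ℂ :=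
  tailProd q r a z P * (1 - (q : ℂ)) ^ (nextCongr r a P / r)

lemma normTail_succ (hq0 : 0 < q) (hq1 : q < 1) (ha : a < r) (z : ℂ) (P : ℕ) :
    normTail q r a z P = bracket q r a ((P : ℤ) + 1) z * normTail q r a z (P + 1) := by
  have hr : 0 < r := by omega
  have hiff : ((P : ℤ) + 1 ≡ (a : ℤ) [ZMOD (r : ℤ)]) ↔ P + 1 ≡ a [MOD r] := by
    rw [← Int.natCast_modEq_iff]; push_cast; rfl
  rw [normTail, normTail, bracket]
  by_cases h : P + 1 ≡ a [MOD r]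
  · rw [if_pos (hiff.2 h)]
    obtain ⟨h1, h2⟩ := nextCongr_succ_of_modEq ha h
    have hL := one_sub_ne_zero hq1
    have e : (q : ℂ) ^ ((((P + 1 + r : ℕ) : ℂ)) + z) =
        ((q ^ r : ℝ) : ℂ) ^ 1 * (q : ℂ) ^ (((P + 1 : ℕ) : ℂ) + z) := by
      rw [pow_r_mul_eq, ← Complex.cpow_add _ _ (ofReal_pos_ne_zero hq0)]
      congr 1
      push_cast
      ring
    rw [tailProd, tailProd, h1, h2, e, Nat.add_div_right _ hr,
      qPochInf_eq_prod_mul (pow_pos hq0 r) (pow_lt_one₀ hq0.le hq1 hr.ne') _ 1, qNumber,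
      Finset.prod_range_one, pow_zero, one_mul, pow_succ (1 - (q : ℂ))]
    push_cast
    field_simp
  · rw [if_neg (mt hiff.1 h), one_mul, tailProd, tailProd, nextCongr_succ_of_not_modEq ha h]

lemma normTail_eq_prod_mul (hq0 : 0 < q) (hq1 : q < 1) (ha : a < r) (z : ℂ) (P k : ℕ) :
    normTail q r a z P =
      (∏ j ∈ Finset.range k, bracket q r a ((P : ℤ) + 1 + j) z) * normTail q r a z (P + k) := by
  induction k with
  | zero => simp
  | succ k ih =>
    rw [ih, Finset.prod_range_succ, normTail_succ hq0 hq1 ha z (P + k), mul_assoc]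
    congr 3
    push_cast
    ring

lemma prod_normTail_bot (hq0 : 0 < q) (hq1 : q < 1) (ha : a < r) (hN : l.colLen 0 ≤ N) (z : ℂ)
    (M : ℕ) :
    ∏ I ∈ Finset.range N, normTail q r a z (betaSet N ⊥ I + M) =
      (∏ x ∈ l.cells, bracket q r a (N + M + content x) z) *
        ∏ I ∈ Finset.range N, normTail q r a z (betaSet N l I + M) := by
  rw [prod_cells hN, ← Finset.prod_mul_distrib]
  refine Finset.prod_congr rfl fun I hI => ?_
  have hI := Finset.mem_range.1 hI
  rw [normTail_eq_prod_mul hq0 hq1 ha z _ (l.rowLen I), betaSet_bot, betaSet, add_right_comm]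
  congr 1
  refine Finset.prod_congr rfl fun j _ => ?_
  congr 1
  simp only [content]
  omega

lemma tailFactor_mul_eq (hq1 : q < 1) (ha : a < r) (hNr : N % r = 0 ∨ N % r = a)
    (hl : ResidueBalanced r l) (hN : l.colLen 0 ≤ N) :
    tailFactor q r a u v N l *
        ∏ J ∈ Finset.range N, (1 - (q : ℂ)) ^ classCard r N ((N - 1 - J) % r) =
      (∏ I ∈ Finset.range N, normTail q r a (r * u + r * v) (betaSet N l I + N)) /
        ∏ I ∈ Finset.range N, normTail q r a (r * u) (betaSet N l I) := by
  have hr : 0 < r := by omega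
  have hL := one_sub_ne_zero hq1
  have e : ∏ J ∈ Finset.range N, (1 - (q : ℂ)) ^ classCard r N ((N - 1 - J) % r) =
      ∏ I ∈ Finset.range N, (1 - (q : ℂ)) ^ classCard r N (betaSet N l I % r) := by
    rw [prod_betaSet_eq_prod_sortedBeta hr hl hN fun P => (1 - (q : ℂ)) ^ classCard r N (P % r)]
    refine Finset.prod_congr rfl fun J hJ => ?_
    rw [sortedBeta_mod hr hl hN (Finset.mem_range.1 hJ)]
  rw [e, tailFactor, ← Finset.prod_mul_distrib, ← Finset.prod_div_distrib]
  refine Finset.prod_congr rfl fun I _ => ?_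
  rw [normTail, normTail, ← mul_classCard ha hNr, Nat.add_mul_div_left _ _ hr, pow_add]
  field_simp

end TailRatio

section Averages

variable {q : ℝ} {r a N : ℕ} {u v : ℂ} {l : YoungDiagram}

lemma card_levelPairs (hr : 0 < r) (hl : ResidueBalanced r l) (hN : l.colLen 0 ≤ N) :
    (levelPairs N (residue r l)).card = (levelPairs N (· % r)).card := by
  have h := prod_levelPairs_sigmaHat hr hl hN fun _ _ => Multiplicative.ofAdd 1
  rw [Finset.prod_const, Finset.prod_const] at h
  simpa [← ofAdd_nsmul] using h

lemma congruentDiff_eq (hq0 : 0 < q) (hq1 : q < 1) (hr : 0 < r) (hl : ResidueBalanced r l)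
    (hN : l.colLen 0 ≤ N) :
    congruentDiff q r N l = congruentDiff q r N ⊥ *
      ((∏ x ∈ l.cells, bracket q r 0 (N + content x) 0) / ∏ x ∈ l.cells, bracket q r 0 (hook l x) 0) := by
  have h := prod_hook_mul_diffProd hN fun m => bracket q r 0 m 0
  rw [diffProd_bracket hr, diffProd_bracket hr, card_levelPairs hr hl hN,
    card_levelPairs hr (residueBalanced_bot hr) (by rw [colLen_bot]; omega)] at h
  have hH : ∏ x ∈ l.cells, bracket q r 0 (hook l x) 0 ≠ 0 :=
    Finset.prod_ne_zero_iff.2 fun x hx => bracket_ne_zero_of_pos hq0 hq1 (hook_pos hx)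
  have hL := pow_ne_zero (levelPairs N (· % r)).card (one_sub_ne_zero hq1)
  generalize (1 - (q : ℂ)) ^ (levelPairs N (· % r)).card = x at *
  field_simp at h ⊢
  linear_combination h

lemma residueBalanced_of_momentDet_ne_zero (ha : a < r) (hN : l.colLen 0 ≤ N)
    (h0 : momentDet q r a u v N ⊥ ≠ 0) (h : momentDet q r a u v N l ≠ 0) :
    ResidueBalanced r l := by
  have hr : 0 < r := by omega
  rw [residueBalanced_iff hr hN]
  intro μ hμ
  have hb := (residueBalanced_iff hr (N := N) (by rw [colLen_bot]; omega)).1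
    (residueBalanced_bot hr) μ hμ
  rw [← hb, ← card_betaSet_eq_count hr hμ, ← card_betaSet_eq_count hr hμ,
    card_betaSet_of_momentDet_ne_zero ha h (gapTo_lt hr μ),
    card_betaSet_of_momentDet_ne_zero ha h0 (gapTo_lt hr μ)]

lemma momentDet_ratio (hq0 : 0 < q) (hq1 : q < 1) (ha : a < r) (hu : -1 < (r : ℝ) * u.re)
    (hN : l.colLen 0 ≤ N) (h0 : momentDet q r a u v N ⊥ ≠ 0) :
    momentDet q r a u v N l / momentDet q r a u v N ⊥ =
      (rSignature r l : ℂ) * ((q ^ r : ℝ) : ℂ) ^ nrPart r l *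
        ∏ x ∈ l.cells,
          (bracket q r 0 (N + content x) 0 * bracket q r a (N + content x) (r * u)) /
          (bracket q r 0 (hook l x) 0 *
            bracket q r a (2 * N + content x) (r * u + r * v)) := by
  have hr : 0 < r := by omega
  by_cases hl : ResidueBalanced r l
  swap
  · have h1 : momentDet q r a u v N l = 0 := by
      by_contra h
      exact hl (residueBalanced_of_momentDet_ne_zero ha hN h0 h)
    rw [h1, rSignature, if_neg (mt (finite_sigmaHat_ne_iff hr).1 hl)]
    simp
  have hNr : N % r = 0 ∨ N % r = a := by
    by_contra h
    exact h0 (momentDet_bot_eq_zero ha h)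
  have hb := residueBalanced_bot hr
  have hbN : (⊥ : YoungDiagram).colLen 0 ≤ N := by rw [colLen_bot]; omega
  have hL := one_sub_ne_zero hq1
  have d0 := momentDet_eq (v := v) hq0 hq1 ha hNr hu hb hbN
  have d1 := momentDet_eq (v := v) hq0 hq1 ha hNr hu hl hN
  have t0 := tailFactor_mul_eq (u := u) (v := v) hq1 ha hNr hb hbN
  have t1 := tailFactor_mul_eq (u := u) (v := v) hq1 ha hNr hl hN
  have n1 := prod_normTail_bot hq0 hq1 ha hN (r * u) 0
  have n2 := prod_normTail_bot hq0 hq1 ha hN (r * u + r * v) N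
  simp only [add_zero, Nat.cast_zero] at n1
  have hκ : ∏ J ∈ Finset.range N, (1 - (q : ℂ)) ^ classCard r N ((N - 1 - J) % r) ≠ 0 :=
    Finset.prod_ne_zero_iff.2 fun _ _ => pow_ne_zero _ hL
  have h2N : ∀ x : ℕ × ℕ, (2 * N + content x : ℤ) = N + N + content x := fun x => by ring
  rw [rSignature_bot hr, Int.cast_one, one_mul] at d0
  rw [congruentDiff_eq hq0 hq1 hr hl hN, powerFactor_eq hq0 hr hl hN] at d1
  rw [d0] at h0
  have hA : ∏ I ∈ Finset.range N, normTail q r a (r * u) (betaSet N ⊥ I) ≠ 0 :=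
    Finset.prod_ne_zero_iff.2 fun I _ =>
      mul_ne_zero (tailProd_ne_zero hq0 hq1 hr hu _) (pow_ne_zero _ hL)
  rw [Finset.prod_div_distrib, Finset.prod_mul_distrib, Finset.prod_mul_distrib]
  simp only [h2N]
  rw [d0, d1]
  rw [n1] at hA t0
  rw [n2] at t0
  generalize ∏ x ∈ l.cells, bracket q r 0 (N + content x) 0 = C0 at *
  generalize ∏ x ∈ l.cells, bracket q r 0 (hook l x) 0 = H at *
  generalize ∏ x ∈ l.cells, bracket q r a (N + content x) (r * u) = C1 at *
  generalize ∏ x ∈ l.cells, bracket q r a (N + N + content x) (r * u + r * v) = C2 at *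
  generalize ∏ J ∈ Finset.range N, (1 - (q : ℂ)) ^ classCard r N ((N - 1 - J) % r) = κ at *
  generalize ∏ I ∈ Finset.range N, normTail q r a (r * u + r * v) (betaSet N l I + N) = B2 at *
  generalize ∏ I ∈ Finset.range N, normTail q r a (r * u) (betaSet N l I) = B1 at *
  have hT0 : tailFactor q r a u v N ⊥ ≠ 0 :=
    right_ne_zero_of_mul (left_ne_zero_of_mul (right_ne_zero_of_mul h0))
  have hC2 : C2 * B2 ≠ 0 := by
    intro h
    rw [h, zero_div] at t0
    exact mul_ne_zero hT0 hκ t0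
  have hC1 := left_ne_zero_of_mul hA
  have hB1 := right_ne_zero_of_mul hA
  have hC2' := left_ne_zero_of_mul hC2
  have hT : tailFactor q r a u v N l = tailFactor q r a u v N ⊥ * (C1 / C2) := by
    apply mul_right_cancel₀ hκ
    rw [t1, mul_right_comm, t0]
    field_simp
  rw [hT, div_eq_iff h0]
  ring

end Averages

end RFoldQSelberg

theorem mainTheorem9 (q : ℝ) (hq0 : 0 < q) (hq1 : q < 1)
    (r a N : ℕ) (hr : 0 < r) (ha : a < r) (u v : ℂ)
    -- the Jackson sums converge at the origin
    (hu : -1 < (r : ℝ) * u.re)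
    -- the weight has no pole at a sample point (for real `v`: `v` is not a negative integer)
    (hv : ∀ n : ℕ, (q : ℂ) ^ ((r : ℂ) * (v + n + 1)) ≠ 1) :
    -- the sums defining the partition function converge absolutely
    (∀ j : Fin N → Fin r,
      Summable (jacksonTerm q (rayEnd r j) (integrand q r u v (fun _ => 1)))) ∧
    -- the partition function
    Z q r a u v N =
      (deltaN r a N : ℂ) / (2 * (Real.pi : ℂ)) ^ N *
        ((q ^ r : ℝ) : ℂ) ^ nrN r a u N * ((r : ℂ) / qNumber q r) ^ N *
        ∏ I ∈ Finset.range N,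
          (qGamma (q ^ r) (fl r I a + (a : ℂ) / r + u + 1) *
            qGamma (q ^ r) (fl r I 0 + v + 1) * qGamma (q ^ r) (fl r I 0 + 1) /
            qGamma (q ^ r) (fl r (N + I) a + (a : ℂ) / r + u + v + 1)) ∧
    -- the Schur averages, for partitions with at most `N` rows
    ∀ l : YoungDiagram, l.colLen 0 ≤ N →
      (∀ j : Fin N → Fin r,
        Summable (jacksonTerm q (rayEnd r j) (integrand q r u v (schur l)))) ∧
      (Z q r a u v N ≠ 0 →
        average q r a u v N (schur l) =
          (rSignature r l : ℂ) * ((q ^ r : ℝ) : ℂ) ^ nrPart r l *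
            ∏ x ∈ l.cells,
              (bracket q r 0 (N + content x) 0 * bracket q r a (N + content x) (r * u)) /
              (bracket q r 0 (hook l x) 0 *
                bracket q r a (2 * N + content x) (r * u + r * v))) := by
  refine ⟨fun j => ?_, Z_eq hq0 hq1 ha hu hv, fun l hl => ⟨fun j => ?_, fun hZ => ?_⟩⟩
  · rw [integrand_one]
    exact (hasSum_jacksonTerm_alternant hq0 hq1 hr hu hv _ _ j).summable
  · rw [integrand_schur]
    exact (hasSum_jacksonTerm_alternant hq0 hq1 hr hu hv _ _ j).summable
  · rw [Z_eq_momentDet hq0 hq1 hr hu hv] at hZ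
    rw [average, ZIns_schur hq0 hq1 hr hu hv, Z_eq_momentDet hq0 hq1 hr hu hv]
    exact momentDet_ratio hq0 hq1 ha hu hl hZ
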